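/- **Proposition (orthogonal decomposition).** Let $d\ge 2$ (in applications $d\in\{2,3\}$) and let $\Omega\subset\mathbb R^d$ be an open set, for instance a bounded Lipschitz domain. Let $s\in H^1(\Omega)$, $\mathbf n\in L^\infty(\Omega;\mathbb R^d)$ and $\mathbf u\in H^1(\Omega;\mathbb R^d)$ satisfy $$-\tfrac1{d-1}<s<1,\qquad |\mathbf n|=1,\qquad \mathbf u=s\,\mathbf n\qquad\text{a.e. in }\Omega,$$ and let $\Sigma=\{x\in\Omega: s(x)=0\}$. Here $\nabla s$ and $\nabla\mathbf u=(\partial_j u_i)_{ij}$ denote the weak gradients, $(a\otimes b)_{ij}=a_ib_j$, and $|A|^2=\sum_{i,j}A_{ij}^2$ for matrices. The field $\mathbf n$ is called $L^2$-differentiable at $x\in\Omega$, with $L^2$-gradient $\nabla\mathbf n(x)\in\mathbb R^{d\times d}$ (which is unique when it exists), if $$\frac1{|B_r(x)|}\int_{B_r(x)}\bigl|\mathbf n(y)-\mathbf n(x)-\nabla\mathbf n(x)(y-x)\bigr|^2\,dy=o(r^2)\qquad\text{as } r\to0^+ .$$ Then $\mathbf n$ is $L^2$-differentiable a.e. in $\Omega\setminus\Sigma$,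 its $L^2$-gradient is $$\nabla\mathbf n=s^{-1}\bigl(\nabla\mathbf u-\mathbf n\otimes\nabla s\bigr)\qquad\text{a.e. in }\Omega\setminus\Sigma,$$ and $$|\nabla\mathbf u|^2=|\nabla s|^2+s^2|\nabla\mathbf n|^2\qquad\text{a.e. in }\Omega\setminus\Sigma .$$ -/

import Mathlib

open MeasureTheory Filter Topology Asymptotics
open scoped ContDiff

/-- `G` is a weak (distributional) derivative of `f` in the open set `Ω`: both are locally
integrable in `Ω` and `∫_Ω (∂_v φ) f = - ∫_Ω φ (G v)` for every direction `v` and every test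
function `φ ∈ C_c^∞(Ω)`. The value `G x` is the linear map `v ↦ G x v`; for a vector field `f`
its matrix in the standard basis has the entries `∂_j f_i`. -/
def HasWeakDeriv {d : ℕ} {V : Type*} [NormedAddCommGroup V] [NormedSpace ℝ V]
    (Ω : Set (EuclideanSpace ℝ (Fin d))) (f : EuclideanSpace ℝ (Fin d) → V)
    (G : EuclideanSpace ℝ (Fin d) → (EuclideanSpace ℝ (Fin d) →L[ℝ] V)) : Prop :=
  LocallyIntegrableOn f Ω ∧ LocallyIntegrableOn G Ω ∧
    ∀ φ : EuclideanSpace ℝ (Fin d) → ℝ, ContDiff ℝ ∞ φ → HasCompactSupport φ → tsupport φ ⊆ Ω →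
      ∀ v : EuclideanSpace ℝ (Fin d),
        ∫ x in Ω, fderiv ℝ φ x v • f x = - ∫ x in Ω, φ x • G x v

/-- The vector field `g` is a weak gradient of the scalar function `f` in `Ω`. -/
def HasWeakGradient {d : ℕ} (Ω : Set (EuclideanSpace ℝ (Fin d)))
    (f : EuclideanSpace ℝ (Fin d) → ℝ)
    (g : EuclideanSpace ℝ (Fin d) → EuclideanSpace ℝ (Fin d)) : Prop :=
  HasWeakDeriv Ω f (fun x => innerSL ℝ (g x))

/-- The Sobolev space `H¹(Ω; V)`: square-integrable functions with a square-integrable weak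
derivative. -/
def MemH1 {d : ℕ} {V : Type*} [NormedAddCommGroup V] [NormedSpace ℝ V]
    (Ω : Set (EuclideanSpace ℝ (Fin d))) (f : EuclideanSpace ℝ (Fin d) → V) : Prop :=
  MemLp f 2 (volume.restrict Ω) ∧
    ∃ G : EuclideanSpace ℝ (Fin d) → (EuclideanSpace ℝ (Fin d) →L[ℝ] V),
      HasWeakDeriv Ω f G ∧ MemLp G 2 (volume.restrict Ω)

/-- The admissible class of triples `(s, n, u) ∈ H¹(Ω) × L^∞(Ω; ℝ^d) × H¹(Ω; ℝ^d)` that satisfy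
`-1/(d-1) < s < 1`, `|n| = 1` and `u = s n` almost everywhere in `Ω`. -/
structure Admissible {d : ℕ} (Ω : Set (EuclideanSpace ℝ (Fin d)))
    (s : EuclideanSpace ℝ (Fin d) → ℝ)
    (n u : EuclideanSpace ℝ (Fin d) → EuclideanSpace ℝ (Fin d)) : Prop where
  memH1_s : MemH1 Ω s
  memLinfty_n : MemLp n ⊤ (volume.restrict Ω)
  memH1_u : MemH1 Ω u
  range_s : ∀ᵐ x ∂(volume.restrict Ω), -1 / ((d : ℝ) - 1) < s x ∧ s x < 1
  norm_n : ∀ᵐ x ∂(volume.restrict Ω), ‖n x‖ = 1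
  u_eq : ∀ᵐ x ∂(volume.restrict Ω), u x = s x • n x

/-- `A` is an `L²`-gradient of `n` at `x`: the mean of `|n(y) - n(x) - A (y - x)|²` over the ball
`B_r(x)` is `o(r²)` as `r → 0⁺`. The first condition says that these means are those of a
square-integrable function for small `r`. -/
def HasL2GradientAt {d : ℕ} (n : EuclideanSpace ℝ (Fin d) → EuclideanSpace ℝ (Fin d))
    (A : EuclideanSpace ℝ (Fin d) →L[ℝ] EuclideanSpace ℝ (Fin d))
    (x : EuclideanSpace ℝ (Fin d)) : Prop :=
  (∀ᶠ r in 𝓝[>] (0 : ℝ),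
      MemLp (fun y => n y - n x - A (y - x)) 2 (volume.restrict (Metric.ball x r))) ∧
    (fun r : ℝ => ⨍ y in Metric.ball x r, ‖n y - n x - A (y - x)‖ ^ 2)
      =o[𝓝[>] (0 : ℝ)] (fun r : ℝ => r ^ 2)

/-- `n` is `L²`-differentiable at `x`. -/
def L2DifferentiableAt {d : ℕ} (n : EuclideanSpace ℝ (Fin d) → EuclideanSpace ℝ (Fin d))
    (x : EuclideanSpace ℝ (Fin d)) : Prop :=
  ∃ A : EuclideanSpace ℝ (Fin d) →L[ℝ] EuclideanSpace ℝ (Fin d), HasL2GradientAt n A x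

open Classical in
/-- The `L²`-gradient of `n` at `x` (it is unique when it exists), and `0` if there is none. -/
noncomputable def l2Gradient {d : ℕ}
    (n : EuclideanSpace ℝ (Fin d) → EuclideanSpace ℝ (Fin d)) (x : EuclideanSpace ℝ (Fin d)) :
    EuclideanSpace ℝ (Fin d) →L[ℝ] EuclideanSpace ℝ (Fin d) :=
  if h : L2DifferentiableAt n x then h.choose else 0

/-- The square `|A|² = ∑_{i,j} A_{ij}²` of the Frobenius norm of the matrix of `A`. -/
noncomputable def frobeniusSq {d : ℕ}
    (A : EuclideanSpace ℝ (Fin d) →L[ℝ] EuclideanSpace ℝ (Fin d)) : ℝ :=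
  ∑ i : Fin d, ∑ j : Fin d, (A (EuclideanSpace.single j 1) i) ^ 2

/-- The tensor product `a ⊗ b` of two vectors, with matrix entries `a_i b_j`, as the linear map
`v ↦ (b · v) a`. -/
noncomputable def vecTensor {d : ℕ} (a b : EuclideanSpace ℝ (Fin d)) :
    EuclideanSpace ℝ (Fin d) →L[ℝ] EuclideanSpace ℝ (Fin d) :=
  (innerSL ℝ b).smulRight a

section

open Metric
open scoped ENNReal Convolution

/-! Away from `s = 0` the field `n` is a quotient of two Sobolev functions, and Sobolev functions
are differentiable in mean square almost everywhere. With remainders R_u, R_s of the first-order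
expansions of `u` and `s` at x, D = n(y) - n(x) and A = s(x)⁻¹(∇u(x) - n(x) ⊗ ∇s(x)), one has
exactly s(x)(D - A(y - x)) = R_u - R_s n(y) - (∇s(x)·(y - x)) D. The first two terms are o(r) in
mean square because |n| = 1, the third because |y - x| < r and x is a Lebesgue point of `n`
(`isL2LittleO_of_smul`).

Expanding |n(x) + D|² = 1 gives 2 n(x)·D = -|D|², which is o(r) in mean square. Hence the linear map
v ↦ n(x)·Av is o(r) and vanishes (`HasL2GradientAt.inner_eq_zero`). Thus ∇u = s A + n ⊗ ∇s is a
Frobenius-orthogonal sum, and Pythagoras yields the last identity.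

The analytic core is `HasWeakDeriv.ae_isL2LittleO`. A Poincaré inequality, proved for C¹ maps and
passed to weak derivatives by mollification, bounds the oscillation of u - ∇u(x) on B_r by r times
the mean-square size of ∇u - ∇u(x) on B_4r, which is o(1) at Lebesgue points. Comparing B_r with
B_{r/2} and summing a geometric series turns oscillation into distance from the value at x. -/

/-- Cauchy-Schwarz inequality with a weight. -/
theorem sq_lintegral_mul_le {α : Type*} [MeasurableSpace α] {μ : Measure α} {k h : α → ℝ≥0∞}
    (hk : AEMeasurable k μ) (hh : AEMeasurable h μ) :
    (∫⁻ a, k a * h a ∂μ) ^ 2 ≤ (∫⁻ a, k a ∂μ) * ∫⁻ a, k a * h a ^ 2 ∂μ := by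
  have h1 := ENNReal.lintegral_mul_le_Lp_mul_Lq μ (p := 2) (q := 2)
    (by rw [Real.holderConjugate_iff]; norm_num)
    (f := fun a => k a ^ (1 / 2 : ℝ)) (g := fun a => k a ^ (1 / 2 : ℝ) * h a)
    (hk.pow_const _) ((hk.pow_const _).mul hh)
  have e1 : ∀ a, ((fun a => k a ^ (1 / 2 : ℝ)) * (fun a => k a ^ (1 / 2 : ℝ) * h a)) a
      = k a * h a := by
    intro a
    simp only [Pi.mul_apply]
    rw [← mul_assoc, ← ENNReal.rpow_add_of_nonneg _ _ (by norm_num) (by norm_num)]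
    norm_num
  have e2 : ∀ a, (k a ^ (1 / 2 : ℝ)) ^ (2 : ℝ) = k a := by
    intro a
    rw [← ENNReal.rpow_mul]; norm_num
  have e3 : ∀ a, (k a ^ (1 / 2 : ℝ) * h a) ^ (2 : ℝ) = k a * h a ^ 2 := by
    intro a
    rw [ENNReal.mul_rpow_of_nonneg _ _ (by norm_num), e2, ENNReal.rpow_two]
  simp only [e1, e2, e3] at h1
  calc _ ≤ ((∫⁻ a, k a ∂μ) ^ (1 / 2 : ℝ) * (∫⁻ a, k a * h a ^ 2 ∂μ) ^ (1 / 2 : ℝ)) ^ 2 := by gcongr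
    _ = _ := by
      rw [mul_pow, ← ENNReal.rpow_two, ← ENNReal.rpow_two, ← ENNReal.rpow_mul, ← ENNReal.rpow_mul]
      norm_num

/-! ### Poincaré inequality for C¹ maps -/

section
variable {E V : Type*} [NormedAddCommGroup E] [NormedSpace ℝ E] [NormedAddCommGroup V]
  [NormedSpace ℝ V] [CompleteSpace V]

/-- Fundamental theorem of calculus along the segment, then Cauchy-Schwarz on the unit interval. -/
theorem enorm_sub_sq_le_lintegral_fderiv {f : E → V} (hf : ContDiff ℝ 1 f) (z h : E) :
    ‖f (z + h) - f z‖ₑ ^ 2 ≤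
      ‖h‖ₑ ^ 2 * ∫⁻ t in Set.Ioc (0 : ℝ) 1, ‖fderiv ℝ f (z + t • h)‖ₑ ^ 2 := by
  have hc : Continuous fun t : ℝ => fderiv ℝ f (z + t • h) :=
    (hf.continuous_fderiv one_ne_zero).comp (by fun_prop)
  have hd : ∀ t ∈ Set.uIcc (0 : ℝ) 1,
      HasDerivAt (fun t : ℝ => f (z + t • h)) (fderiv ℝ f (z + t • h) h) t := by
    intro t _
    have h1 := (hf.differentiable one_ne_zero (z + t • h)).hasFDerivAt
    have h2 : HasDerivAt (fun t : ℝ => z + t • h) h t := by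
      simpa using ((hasDerivAt_id t).smul_const h).const_add z
    exact h1.comp_hasDerivAt t h2
  have key := intervalIntegral.integral_eq_sub_of_hasDerivAt hd
    ((hc.clm_apply continuous_const).intervalIntegrable 0 1)
  simp only [one_smul, zero_smul, add_zero] at key
  rw [← key, intervalIntegral.integral_of_le zero_le_one]
  have hm : Measurable fun t : ℝ => ‖fderiv ℝ f (z + t • h)‖ₑ := hc.enorm.measurable
  calc _ ≤ (∫⁻ t in Set.Ioc (0 : ℝ) 1, ‖fderiv ℝ f (z + t • h) h‖ₑ) ^ 2 := by
        gcongr; exact enorm_integral_le_lintegral_enorm _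
    _ ≤ (∫⁻ t in Set.Ioc (0 : ℝ) 1, ‖h‖ₑ * ‖fderiv ℝ f (z + t • h)‖ₑ) ^ 2 := by
        gcongr with t
        rw [mul_comm]
        exact ContinuousLinearMap.le_opENorm _ _
    _ = ‖h‖ₑ ^ 2 * (∫⁻ t in Set.Ioc (0 : ℝ) 1, 1 * ‖fderiv ℝ f (z + t • h)‖ₑ) ^ 2 := by
        rw [lintegral_const_mul _ hm, mul_pow]; simp
    _ ≤ ‖h‖ₑ ^ 2 * ((∫⁻ t in Set.Ioc (0 : ℝ) 1, 1) *
          ∫⁻ t in Set.Ioc (0 : ℝ) 1, 1 * ‖fderiv ℝ f (z + t • h)‖ₑ ^ 2) := by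
        gcongr
        exact sq_lintegral_mul_le aemeasurable_const hm.aemeasurable
    _ = _ := by simp

variable [MeasurableSpace E] [BorelSpace E] [FiniteDimensional ℝ E]
  {μ : Measure E} [μ.IsAddHaarMeasure]

/-- Integrate the segment bound and apply Tonelli: for each t in (0, 1] the translate of the ball by
t h stays in the ball of radius r + ‖h‖. -/
theorem lintegral_enorm_translate_sub_sq_le {f : E → V} (hf : ContDiff ℝ 1 f) (x h : E) (r : ℝ) :
    ∫⁻ z in ball x r, ‖f (z + h) - f z‖ₑ ^ 2 ∂μ ≤
      ‖h‖ₑ ^ 2 * ∫⁻ w in ball x (r + ‖h‖), ‖fderiv ℝ f w‖ₑ ^ 2 ∂μ := by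
  have hD : Continuous (fderiv ℝ f) := hf.continuous_fderiv one_ne_zero
  have hm : Measurable fun w => ‖fderiv ℝ f w‖ₑ ^ 2 := hD.enorm.measurable.pow_const 2
  have hc : Measurable fun p : E × ℝ => ‖fderiv ℝ f (p.1 + p.2 • h)‖ₑ ^ 2 :=
    (hD.comp (by fun_prop)).enorm.measurable.pow_const 2
  have : ProperSpace E := FiniteDimensional.proper ℝ E
  calc _ ≤ ∫⁻ z in ball x r, ‖h‖ₑ ^ 2 *
          (∫⁻ t in Set.Ioc (0 : ℝ) 1, ‖fderiv ℝ f (z + t • h)‖ₑ ^ 2) ∂μ := by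
        gcongr with z; exact enorm_sub_sq_le_lintegral_fderiv hf z h
    _ = ‖h‖ₑ ^ 2 * ∫⁻ z in ball x r,
          (∫⁻ t in Set.Ioc (0 : ℝ) 1, ‖fderiv ℝ f (z + t • h)‖ₑ ^ 2) ∂μ :=
        lintegral_const_mul' _ _ (by simp)
    _ = ‖h‖ₑ ^ 2 * ∫⁻ t in Set.Ioc (0 : ℝ) 1, ∫⁻ z in ball x r,
          ‖fderiv ℝ f (z + t • h)‖ₑ ^ 2 ∂μ := by
        rw [lintegral_lintegral_swap hc.aemeasurable]
    _ ≤ ‖h‖ₑ ^ 2 * ∫⁻ t in Set.Ioc (0 : ℝ) 1, ∫⁻ w in ball x (r + ‖h‖),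
          ‖fderiv ℝ f w‖ₑ ^ 2 ∂μ := by
        gcongr ‖h‖ₑ ^ 2 * ?_
        refine setLIntegral_mono' measurableSet_Ioc fun t ht => ?_
        rw [← lintegral_indicator measurableSet_ball, ← lintegral_indicator measurableSet_ball,
          ← lintegral_add_right_eq_self (μ := μ)
            ((ball x (r + ‖h‖)).indicator fun w => ‖fderiv ℝ f w‖ₑ ^ 2) (t • h)]
        refine lintegral_mono fun z => ?_
        by_cases hz : z ∈ ball x r
        · have : z + t • h ∈ ball x (r + ‖h‖) := by
            rw [mem_ball] at hz ⊢
            have h1 : dist (z + t • h) z ≤ ‖h‖ := by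
              rw [dist_eq_norm, add_sub_cancel_left, norm_smul, Real.norm_of_nonneg ht.1.le]
              exact mul_le_of_le_one_left (norm_nonneg _) ht.2
            linarith [dist_triangle (z + t • h) z x]
          rw [Set.indicator_of_mem hz, Set.indicator_of_mem this]
        · rw [Set.indicator_of_notMem hz]; exact zero_le
    _ = _ := by simp

/-- A form of the Poincaré inequality on balls, with an enlarged ball on the right-hand side. -/
theorem lintegral_lintegral_enorm_sub_sq_le {f : E → V} (hf : ContDiff ℝ 1 f) (x : E) {r : ℝ} :
    ∫⁻ z in ball x r, ∫⁻ y in ball x r, ‖f y - f z‖ₑ ^ 2 ∂μ ∂μ ≤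
      μ (ball 0 (2 * r)) * (ENNReal.ofReal (2 * r) ^ 2 *
        ∫⁻ w in ball x (3 * r), ‖fderiv ℝ f w‖ₑ ^ 2 ∂μ) := by
  have : ProperSpace E := FiniteDimensional.proper ℝ E
  have hfc := hf.continuous
  have hc : Measurable fun p : E × E => ‖f (p.1 + p.2) - f p.1‖ₑ ^ 2 := by
    refine (Continuous.enorm ?_).measurable.pow_const 2
    fun_prop
  -- Substitute y = z + h; two points of the ball differ by less than 2r, whence the radius 3r = r +
  -- 2r below.
  calc _ ≤ ∫⁻ z in ball x r, ∫⁻ h in ball 0 (2 * r), ‖f (z + h) - f z‖ₑ ^ 2 ∂μ ∂μ := by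
        refine setLIntegral_mono' measurableSet_ball fun z hz => ?_
        rw [← lintegral_indicator measurableSet_ball, ← lintegral_indicator measurableSet_ball,
          ← lintegral_add_left_eq_self (μ := μ) _ z]
        refine lintegral_mono fun h => ?_
        by_cases hh : z + h ∈ ball x r
        · have : h ∈ ball (0 : E) (2 * r) := by
            rw [mem_ball] at hh hz ⊢
            have h1 : dist h 0 = dist (z + h) z := by simp [dist_eq_norm]
            linarith [dist_triangle_right (z + h) z x]
          rw [Set.indicator_of_mem hh, Set.indicator_of_mem this]
        · rw [Set.indicator_of_notMem hh]; exact zero_le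
    _ = ∫⁻ h in ball 0 (2 * r), ∫⁻ z in ball x r, ‖f (z + h) - f z‖ₑ ^ 2 ∂μ ∂μ :=
        lintegral_lintegral_swap hc.aemeasurable
    _ ≤ ∫⁻ h in ball 0 (2 * r), ENNReal.ofReal (2 * r) ^ 2 *
        ∫⁻ w in ball x (3 * r), ‖fderiv ℝ f w‖ₑ ^ 2 ∂μ ∂μ := by
        refine setLIntegral_mono' measurableSet_ball fun h hh => ?_
        rw [mem_ball_zero_iff] at hh
        refine (lintegral_enorm_translate_sub_sq_le hf x h r).trans ?_
        gcongr
        · rw [← ofReal_norm]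
          exact ENNReal.ofReal_le_ofReal hh.le
        · linarith
    _ = _ := by simp [mul_comm]

end

/-! ### Mollification and the Poincaré inequality for weak derivatives -/

section
variable {d : ℕ} {V : Type*} [NormedAddCommGroup V] [NormedSpace ℝ V]
  {Ω : Set (EuclideanSpace ℝ (Fin d))}

theorem MeasureTheory.LocallyIntegrableOn.integrableOn_smul_of_tsupport_subset
    {W : Type*} [NormedAddCommGroup W] [NormedSpace ℝ W]
    {g : EuclideanSpace ℝ (Fin d) → W} (hg : LocallyIntegrableOn g Ω)
    {k : EuclideanSpace ℝ (Fin d) → ℝ} (hk : Continuous k) (hc : HasCompactSupport k)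
    (hs : tsupport k ⊆ Ω) : IntegrableOn (fun y => k y • g y) Ω := by
  have h1 : IntegrableOn g (tsupport k) := hg.integrableOn_compact_subset hs hc
  have h2 : IntegrableOn (fun y => k y • g y) (tsupport k) :=
    h1.continuousOn_smul hk.continuousOn hc
  refine IntegrableOn.integrable_of_forall_notMem_eq_zero h2 (fun y hy => ?_) |>.integrableOn
  simp [image_eq_zero_of_notMem_tsupport hy]

variable {u : EuclideanSpace ℝ (Fin d) → V}
  {G : EuclideanSpace ℝ (Fin d) → (EuclideanSpace ℝ (Fin d) →L[ℝ] V)}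

/-- The convolution of `f` with a normalized bump function. -/
noncomputable def mollify (φ : ContDiffBump (0 : EuclideanSpace ℝ (Fin d)))
    (f : EuclideanSpace ℝ (Fin d) → V) : EuclideanSpace ℝ (Fin d) → V :=
  φ.normed volume ⋆[ContinuousLinearMap.lsmul ℝ ℝ, volume] f

theorem contDiff_mollify (φ : ContDiffBump (0 : EuclideanSpace ℝ (Fin d)))
    {f : EuclideanSpace ℝ (Fin d) → V} (hf : LocallyIntegrable f) :
    ContDiff ℝ 1 (mollify φ f) :=
  φ.hasCompactSupport_normed.contDiff_convolution_left (n := 1) _ φ.contDiff_normed hf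

theorem hasCompactSupport_normed_sub_left (φ : ContDiffBump (0 : EuclideanSpace ℝ (Fin d)))
    (w : EuclideanSpace ℝ (Fin d)) :
    HasCompactSupport (fun y => φ.normed volume (w - y)) :=
  φ.hasCompactSupport_normed.comp_homeomorph (Homeomorph.subLeft w)

theorem tsupport_normed_sub_left_subset (φ : ContDiffBump (0 : EuclideanSpace ℝ (Fin d)))
    (w : EuclideanSpace ℝ (Fin d)) :
    tsupport (fun y => φ.normed volume (w - y)) ⊆ closedBall w φ.rOut := by
  refine closure_minimal (fun y hy => ?_) isClosed_closedBall
  have : w - y ∈ Function.support (φ.normed volume) := hy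
  rw [φ.support_normed_eq, mem_ball_zero_iff] at this
  rw [mem_closedBall, dist_comm, dist_eq_norm]
  exact this.le

/-- The derivative falls on the kernel, and y ↦ φ(w - y) is an admissible test function because its
support lies in Ω. The sign from differentiating in y instead of w cancels the sign in the weak
derivative. -/
theorem HasWeakDeriv.fderiv_mollify (hw : HasWeakDeriv Ω u G) (hΩ : IsOpen Ω)
    (hu : LocallyIntegrable (Ω.indicator u))
    (φ : ContDiffBump (0 : EuclideanSpace ℝ (Fin d))) {w : EuclideanSpace ℝ (Fin d)}
    (hwΩ : closedBall w φ.rOut ⊆ Ω) :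
    fderiv ℝ (mollify φ (Ω.indicator u)) w = ∫ y in Ω, φ.normed volume (w - y) • G y := by
  have hk : ContDiff ℝ ∞ (fun y => φ.normed volume (w - y)) :=
    (φ.contDiff_normed (n := ⊤)).comp (contDiff_const.sub contDiff_id)
  have hkc := hasCompactSupport_normed_sub_left φ w
  have hks := (tsupport_normed_sub_left_subset φ w).trans hwΩ
  have hI := hw.2.1.integrableOn_smul_of_tsupport_subset hk.continuous hkc hks
  have hφ1 : ContDiff ℝ 1 (φ.normed (volume : Measure (EuclideanSpace ℝ (Fin d)))) :=
    φ.contDiff_normed (n := 1)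
  ext v
  rw [ContinuousLinearMap.integral_apply hI]
  have h1 := φ.hasCompactSupport_normed.hasFDerivAt_convolution_left
    (ContinuousLinearMap.lsmul ℝ ℝ) hφ1 hu w
  rw [mollify, h1.fderiv, convolution_eq_swap, ContinuousLinearMap.integral_apply]
  · have h2 := hw.2.2 _ hk hkc hks v
    have h3 : ∀ y, fderiv ℝ (fun y => φ.normed volume (w - y)) y v
        = - fderiv ℝ (φ.normed volume) (w - y) v := by
      intro y
      have h4 : HasFDerivAt (fun y => w - y)
        (-ContinuousLinearMap.id ℝ (EuclideanSpace ℝ (Fin d))) y := (hasFDerivAt_id y).const_sub w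
      have h5 := ((hφ1.differentiable one_ne_zero (w - y)).hasFDerivAt).comp y h4
      have h6 := h5.fderiv
      simp only [Function.comp_def] at h6
      rw [h6]; simp
    simp only [h3, neg_smul, integral_neg, neg_inj] at h2
    simp only [smul_apply]
    rw [← h2, ← integral_indicator hΩ.measurableSet]
    congr 1 with y
    by_cases hy : y ∈ Ω <;> simp [hy, ContinuousLinearMap.precompL_apply]
  · have h7 := (φ.hasCompactSupport_normed.fderiv ℝ).convolutionExists_left
      ((ContinuousLinearMap.lsmul ℝ ℝ : ℝ →L[ℝ] V →L[ℝ] V).precompL (EuclideanSpace ℝ (Fin d)))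
      (hφ1.continuous_fderiv one_ne_zero) hu w
    exact h7.integrable_swap

variable [CompleteSpace V]

/-- Jensen's inequality: the kernel is a probability density supported in Ω, so `A` is its own
average. -/
theorem HasWeakDeriv.enorm_fderiv_mollify_sub_sq_le (hw : HasWeakDeriv Ω u G) (hΩ : IsOpen Ω)
    (hu : LocallyIntegrable (Ω.indicator u)) (A : EuclideanSpace ℝ (Fin d) →L[ℝ] V)
    (φ : ContDiffBump (0 : EuclideanSpace ℝ (Fin d))) {w : EuclideanSpace ℝ (Fin d)}
    (hwΩ : closedBall w φ.rOut ⊆ Ω) :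
    ‖fderiv ℝ (mollify φ (Ω.indicator u)) w - A‖ₑ ^ 2 ≤
      ∫⁻ y in Ω, ‖φ.normed volume (w - y)‖ₑ * ‖G y - A‖ₑ ^ 2 := by
  have hk : Continuous (fun y => φ.normed volume (w - y)) :=
    φ.continuous_normed.comp (by fun_prop)
  have hkc := hasCompactSupport_normed_sub_left φ w
  have hks := (tsupport_normed_sub_left_subset φ w).trans hwΩ
  have hI := hw.2.1.integrableOn_smul_of_tsupport_subset hk hkc hks
  have hI' : IntegrableOn (fun y => φ.normed volume (w - y) • A) Ω :=
    ((hk.integrable_of_hasCompactSupport hkc).smul_const A).integrableOn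
  have hone : ∫ y, φ.normed volume (w - y) = 1 := by
    rw [integral_sub_left_eq_self (φ.normed volume), φ.integral_normed]
  have hA : A = ∫ y in Ω, φ.normed volume (w - y) • A := by
    rw [setIntegral_eq_integral_of_forall_compl_eq_zero, integral_smul_const, hone, one_smul]
    intro y hy
    have : y ∉ tsupport (fun y => φ.normed volume (w - y)) := fun h => hy (hks h)
    simp [image_eq_zero_of_notMem_tsupport this]
  have hone' : ∫⁻ y in Ω, ‖φ.normed volume (w - y)‖ₑ ≤ 1 := by
    refine (setLIntegral_le_lintegral _ _).trans ?_
    have : ∀ y, ‖φ.normed volume (w - y)‖ₑ = ENNReal.ofReal (φ.normed volume (w - y)) :=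
      fun y => Real.enorm_of_nonneg (φ.nonneg_normed _)
    simp only [this]
    rw [← ofReal_integral_eq_lintegral_ofReal (hk.integrable_of_hasCompactSupport hkc)
      (Eventually.of_forall fun y => φ.nonneg_normed _), hone, ENNReal.ofReal_one]
  have hGm : AEStronglyMeasurable G (volume.restrict Ω) := hw.2.1.aestronglyMeasurable
  rw [hw.fderiv_mollify hΩ hu φ hwΩ]
  conv_lhs => rw [hA, ← integral_sub hI hI']
  simp only [← smul_sub]
  calc _ ≤ (∫⁻ y in Ω, ‖φ.normed volume (w - y) • (G y - A)‖ₑ) ^ 2 := by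
        gcongr; exact enorm_integral_le_lintegral_enorm _
    _ = (∫⁻ y in Ω, ‖φ.normed volume (w - y)‖ₑ * ‖G y - A‖ₑ) ^ 2 := by simp only [enorm_smul]
    _ ≤ _ := sq_lintegral_mul_le hk.enorm.measurable.aemeasurable
        (hGm.sub aestronglyMeasurable_const).enorm
    _ ≤ 1 * _ := by gcongr
    _ = _ := one_mul _

theorem HasWeakDeriv.lintegral_fderiv_mollify_sub_sq_le (hw : HasWeakDeriv Ω u G) (hΩ : IsOpen Ω)
    (hu : LocallyIntegrable (Ω.indicator u)) (A : EuclideanSpace ℝ (Fin d) →L[ℝ] V)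
    (φ : ContDiffBump (0 : EuclideanSpace ℝ (Fin d))) {x : EuclideanSpace ℝ (Fin d)} {r r' : ℝ}
    (hr : r + φ.rOut ≤ r') (hxΩ : ball x r' ⊆ Ω) :
    ∫⁻ w in ball x r, ‖fderiv ℝ (mollify φ (Ω.indicator u)) w - A‖ₑ ^ 2 ≤
      ∫⁻ y in ball x r', ‖G y - A‖ₑ ^ 2 := by
  have hGm : AEStronglyMeasurable G (volume.restrict (ball x r')) :=
    hw.2.1.aestronglyMeasurable.mono_measure (Measure.restrict_mono hxΩ le_rfl)
  have hHm : AEMeasurable (fun y => ‖G y - A‖ₑ ^ 2) (volume.restrict (ball x r')) :=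
    (hGm.sub aestronglyMeasurable_const).enorm.pow_const 2
  have hsub : ∀ w ∈ ball x r, closedBall w φ.rOut ⊆ ball x r' := fun w hw' =>
    closedBall_subset_ball' (by rw [mem_ball] at hw'; linarith)
  calc _ ≤ ∫⁻ w in ball x r, ∫⁻ y in ball x r',
          ‖φ.normed volume (w - y)‖ₑ * ‖G y - A‖ₑ ^ 2 := by
        refine setLIntegral_mono' measurableSet_ball fun w hwb => ?_
        have hw' := hsub w hwb
        refine (hw.enorm_fderiv_mollify_sub_sq_le hΩ hu A φ (hw'.trans hxΩ)).trans ?_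
        rw [← lintegral_indicator hΩ.measurableSet, ← lintegral_indicator measurableSet_ball]
        refine lintegral_mono fun y => ?_
        by_cases hy : y ∈ ball x r'
        · rw [Set.indicator_of_mem hy, Set.indicator_of_mem (hxΩ hy)]
        · have : φ.normed volume (w - y) = 0 := by
            have : y ∉ tsupport (fun y => φ.normed volume (w - y)) := fun h =>
              hy (hw' (tsupport_normed_sub_left_subset φ w h))
            exact image_eq_zero_of_notMem_tsupport (f := fun y => φ.normed volume (w - y)) this
          rw [Set.indicator_of_notMem hy]
          by_cases hy' : y ∈ Ω <;> simp [hy', this]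
    _ = ∫⁻ y in ball x r', ∫⁻ w in ball x r,
          ‖φ.normed volume (w - y)‖ₑ * ‖G y - A‖ₑ ^ 2 := by
        refine lintegral_lintegral_swap (AEMeasurable.mul ?_ hHm.comp_snd)
        have : Continuous fun p : EuclideanSpace ℝ (Fin d) × EuclideanSpace ℝ (Fin d) =>
          φ.normed volume (p.1 - p.2) := φ.continuous_normed.comp (by fun_prop)
        exact this.enorm.measurable.aemeasurable
    _ ≤ ∫⁻ y in ball x r', 1 * ‖G y - A‖ₑ ^ 2 := by
        refine lintegral_mono fun y => ?_
        rw [lintegral_mul_const' _ _ (by simp)]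
        gcongr
        refine (setLIntegral_le_lintegral _ _).trans ?_
        rw [lintegral_sub_right_eq_self (fun w => ‖φ.normed volume w‖ₑ) y]
        simp only [fun w => Real.enorm_of_nonneg (φ.nonneg_normed (μ := volume) w)]
        rw [← ofReal_integral_eq_lintegral_ofReal φ.integrable_normed
          (Eventually.of_forall fun y => φ.nonneg_normed _), φ.integral_normed, ENNReal.ofReal_one]
    _ = _ := by simp

/-- A form of the Poincaré inequality on balls for weakly differentiable functions. -/
theorem HasWeakDeriv.lintegral_lintegral_enorm_sub_sq_le (hw : HasWeakDeriv Ω u G) (hΩ : IsOpen Ω)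
    (hu : LocallyIntegrable (Ω.indicator u)) (A : EuclideanSpace ℝ (Fin d) →L[ℝ] V)
    {x : EuclideanSpace ℝ (Fin d)} {r : ℝ} (hr : 0 < r) (hxΩ : ball x (4 * r) ⊆ Ω) :
    ∫⁻ z in ball x r, ∫⁻ y in ball x r, ‖(u y - A y) - (u z - A z)‖ₑ ^ 2 ≤
      volume (ball (0 : EuclideanSpace ℝ (Fin d)) (2 * r)) * (ENNReal.ofReal (2 * r) ^ 2 *
        ∫⁻ w in ball x (4 * r), ‖G w - A‖ₑ ^ 2) := by
  -- Outer radii at most r keep the mollified gradient on B_3r controlled by `G` on B_4r; the fixed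
  -- ratio 2 of outer to inner radius gives almost everywhere convergence.
  have hpos : ∀ m : ℕ, 0 < r / (m + 1) := fun m => by positivity
  let φ : ℕ → ContDiffBump (0 : EuclideanSpace ℝ (Fin d)) := fun m =>
    ⟨r / (m + 1) / 2, r / (m + 1), half_pos (hpos m), half_lt_self (hpos m)⟩
  have hφ : Tendsto (fun m => (φ m).rOut) atTop (𝓝 0) :=
    tendsto_const_div_atTop_nhds_zero_nat r |>.comp (tendsto_add_atTop_nat 1) |>.congr
      fun m => by simp [φ]
  have hae := ContDiffBump.ae_convolution_tendsto_right_of_locallyIntegrable (μ := volume)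
    (φ := φ) (K := 2) hφ (Eventually.of_forall fun m => by simp [φ]; linarith) hu
  have hball : ∀ y ∈ ball x r, y ∈ Ω := fun y hy => hxΩ (ball_subset_ball (by linarith) hy)
  have hae' : ∀ᵐ y ∂(volume.restrict (ball x r)),
      Tendsto (fun m => mollify (φ m) (Ω.indicator u) y - A y) atTop (𝓝 (u y - A y)) := by
    filter_upwards [ae_restrict_of_ae hae, ae_restrict_mem measurableSet_ball] with y hy hyb
    rw [Set.indicator_of_mem (hball y hyb)] at hy
    exact hy.sub_const _
  have hsm : ∀ m, ContDiff ℝ 1 (fun y => mollify (φ m) (Ω.indicator u) y - A y) := fun m =>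
    (contDiff_mollify (φ m) hu).sub A.contDiff
  have hcont : ∀ m, Continuous (fun p : EuclideanSpace ℝ (Fin d) × EuclideanSpace ℝ (Fin d) =>
      (mollify (φ m) (Ω.indicator u) p.2 - A p.2) -
        (mollify (φ m) (Ω.indicator u) p.1 - A p.1)) := fun m =>
    ((hsm m).continuous.comp continuous_snd).sub ((hsm m).continuous.comp continuous_fst)
  -- Fatou's lemma in each variable in turn.
  calc _ ≤ ∫⁻ z in ball x r, liminf (fun m => ∫⁻ y in ball x r,
          ‖(mollify (φ m) (Ω.indicator u) y - A y) -
            (mollify (φ m) (Ω.indicator u) z - A z)‖ₑ ^ 2) atTop := by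
        refine lintegral_mono_ae ?_
        filter_upwards [hae'] with z hz
        refine le_trans (lintegral_mono_ae ?_) (lintegral_liminf_le fun m => ?_)
        · filter_upwards [hae'] with y hy
          refine le_of_eq (Tendsto.liminf_eq ?_).symm
          exact (ENNReal.continuous_pow 2).tendsto _ |>.comp ((hy.sub hz).enorm)
        · exact ((hcont m).comp (Continuous.prodMk_right z)).enorm.measurable.pow_const 2
    _ ≤ liminf (fun m => ∫⁻ z in ball x r, ∫⁻ y in ball x r,
          ‖(mollify (φ m) (Ω.indicator u) y - A y) -
            (mollify (φ m) (Ω.indicator u) z - A z)‖ₑ ^ 2) atTop := by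
        refine lintegral_liminf_le fun m => ?_
        exact ((hcont m).enorm.measurable.pow_const 2).lintegral_prod_right'
    _ ≤ liminf (fun _ : ℕ => volume (ball (0 : EuclideanSpace ℝ (Fin d)) (2 * r)) *
          (ENNReal.ofReal (2 * r) ^ 2 * ∫⁻ w in ball x (4 * r), ‖G w - A‖ₑ ^ 2)) atTop := by
        refine liminf_le_liminf (Eventually.of_forall fun m => ?_)
        refine (_root_.lintegral_lintegral_enorm_sub_sq_le (hsm m) x).trans ?_
        gcongr volume _ * (_ * ?_)
        refine le_trans (le_of_eq ?_) (hw.lintegral_fderiv_mollify_sub_sq_le hΩ hu A (φ m)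
          (r := 3 * r) ?_ hxΩ)
        · congr 1 with w
          have h1 := (((contDiff_mollify (φ m) hu).differentiable one_ne_zero w).hasFDerivAt.sub
            A.hasFDerivAt).fderiv
          have h2 : fderiv ℝ (fun y => mollify (φ m) (Ω.indicator u) y - A y) w = _ := h1
          rw [h2]
        · have : r / ((m : ℝ) + 1) ≤ r := div_le_self hr.le (by linarith [m.cast_nonneg (α := ℝ)])
          simp only [φ]; linarith
    _ = _ := by simp

end

/-! ### Mean-square smallness over balls and Lebesgue points -/

theorem eLpNorm_two_sq {α W : Type*} [MeasurableSpace α] [NormedAddCommGroup W] (h : α → W)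
    (μ : Measure α) : eLpNorm h 2 μ ^ 2 = ∫⁻ a, ‖h a‖ₑ ^ 2 ∂μ := by
  rw [eLpNorm_eq_lintegral_rpow_enorm_toReal two_ne_zero ENNReal.ofNat_ne_top, ← ENNReal.rpow_two,
    ← ENNReal.rpow_mul]
  simp

section
variable {d : ℕ} {V W : Type*} [NormedAddCommGroup V] [NormedAddCommGroup W]

/-- The uniform probability measure on a ball. -/
noncomputable def unifBall (x : EuclideanSpace ℝ (Fin d)) (r : ℝ) :
    Measure (EuclideanSpace ℝ (Fin d)) :=
  (volume (ball x r))⁻¹ • volume.restrict (ball x r)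

theorem isProbabilityMeasure_unifBall (x : EuclideanSpace ℝ (Fin d)) {r : ℝ} (hr : 0 < r) :
    IsProbabilityMeasure (unifBall x r) := by
  constructor
  simp only [unifBall, Measure.smul_apply, Measure.restrict_apply_univ, smul_eq_mul]
  exact ENNReal.inv_mul_cancel (measure_ball_pos _ _ hr).ne' measure_ball_lt_top.ne

theorem unifBall_absolutelyContinuous (x : EuclideanSpace ℝ (Fin d)) (r : ℝ) :
    unifBall x r ≪ volume.restrict (ball x r) :=
  Measure.smul_absolutelyContinuous

theorem ae_unifBall_mem (x : EuclideanSpace ℝ (Fin d)) (r : ℝ) :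
    ∀ᵐ y ∂(unifBall x r), y ∈ ball x r :=
  (unifBall_absolutelyContinuous x r).ae_le (ae_restrict_mem measurableSet_ball)

theorem lintegral_unifBall (x : EuclideanSpace ℝ (Fin d)) (r : ℝ)
    (f : EuclideanSpace ℝ (Fin d) → ℝ≥0∞) :
    ∫⁻ y, f y ∂(unifBall x r) = (volume (ball x r))⁻¹ * ∫⁻ y in ball x r, f y := by
  rw [unifBall, lintegral_smul_measure, smul_eq_mul]

theorem integral_unifBall (x : EuclideanSpace ℝ (Fin d)) (r : ℝ)
    (f : EuclideanSpace ℝ (Fin d) → ℝ) :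
    ∫ y, f y ∂(unifBall x r) = ⨍ y in ball x r, f y := by
  rw [average, Measure.restrict_apply_univ, unifBall]

theorem volume_ball_mul (x z : EuclideanSpace ℝ (Fin d)) {c : ℝ} (hc : 0 < c) (r : ℝ) :
    volume (ball x (c * r)) = ENNReal.ofReal (c ^ d) * volume (ball z r) := by
  rw [Measure.addHaar_ball_mul_of_pos _ _ hc, Measure.addHaar_ball_center,
    Measure.addHaar_ball_center _ z]
  simp

theorem unifBall_half_le (x : EuclideanSpace ℝ (Fin d)) {r : ℝ} (hr : 0 < r) :
    unifBall x (r / 2) ≤ (2 : ℝ≥0∞) ^ d • unifBall x r := by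
  have h2 : volume (ball x r) = 2 ^ d * volume (ball x (r / 2)) := by
    have := volume_ball_mul x x two_pos (r / 2)
    rw [mul_div_cancel₀ _ two_ne_zero] at this
    rw [this, ENNReal.ofReal_pow zero_le_two, ENNReal.ofReal_ofNat]
  have h3 : (2 : ℝ≥0∞) ^ d * (volume (ball x r))⁻¹ = (volume (ball x (r / 2)))⁻¹ := by
    rw [h2, ENNReal.mul_inv (by simp) (by simp), ← mul_assoc, ENNReal.mul_inv_cancel (by simp)
      (by simp), one_mul]
  rw [unifBall, unifBall, smul_smul, h3]
  intro s
  simp only [Measure.smul_apply, smul_eq_mul]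
  gcongr
  linarith

/-- `h(y) = o(r ^ k)` in the mean of order two over the balls `B_r(x)`. -/
def IsL2LittleO (h : EuclideanSpace ℝ (Fin d) → V) (x : EuclideanSpace ℝ (Fin d)) (k : ℕ) : Prop :=
  ∀ ε : ℝ, 0 < ε → ∀ᶠ r in 𝓝[>] (0 : ℝ), AEStronglyMeasurable h (unifBall x r) ∧
    eLpNorm h 2 (unifBall x r) ≤ ENNReal.ofReal (ε * r ^ k)

variable {h h' : EuclideanSpace ℝ (Fin d) → V} {x : EuclideanSpace ℝ (Fin d)} {k : ℕ}

theorem IsL2LittleO.eventually_aestronglyMeasurable (hh : IsL2LittleO h x k) :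
    ∀ᶠ r in 𝓝[>] (0 : ℝ), AEStronglyMeasurable h (unifBall x r) :=
  (hh 1 one_pos).mono fun _ hr => hr.1

theorem IsL2LittleO.add (hh : IsL2LittleO h x k) (hh' : IsL2LittleO h' x k) :
    IsL2LittleO (fun y => h y + h' y) x k := by
  intro ε hε
  filter_upwards [hh (ε / 2) (half_pos hε), hh' (ε / 2) (half_pos hε), self_mem_nhdsWithin]
    with r h1 h2 hr
  have hr : 0 < r := hr
  refine ⟨h1.1.add h2.1, (eLpNorm_add_le h1.1 h2.1 one_le_two).trans ?_⟩
  refine (add_le_add h1.2 h2.2).trans ?_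
  rw [← ENNReal.ofReal_add (by positivity) (by positivity)]
  apply le_of_eq; congr 1; ring

/-- All products below are estimated through this: a pointwise factor of size r ^ j on the ball
raises the order by j. -/
theorem IsL2LittleO.of_bound {g : EuclideanSpace ℝ (Fin d) → W} (hh : IsL2LittleO h x k)
    (hg : ∀ᶠ r in 𝓝[>] (0 : ℝ), AEStronglyMeasurable g (unifBall x r)) (C : ℝ) (j : ℕ)
    (hb : ∀ᶠ r in 𝓝[>] (0 : ℝ), ∀ᵐ y ∂(unifBall x r), ‖g y‖ ≤ C * r ^ j * ‖h y‖) :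
    IsL2LittleO g x (k + j) := by
  intro ε hε
  filter_upwards [hh (ε / (|C| + 1)) (by positivity), hg, hb, self_mem_nhdsWithin]
    with r h1 h2 h3 hr
  have hr : 0 < r := hr
  refine ⟨h2, ?_⟩
  have h4 : ∀ᵐ y ∂(unifBall x r), ‖g y‖ ≤ ((|C| + 1) * r ^ j) * ‖h y‖ := by
    filter_upwards [h3] with y hy
    refine hy.trans ?_
    gcongr
    linarith [le_abs_self C]
  refine (eLpNorm_le_mul_eLpNorm_of_ae_le_mul h4 2).trans ?_
  refine (mul_le_mul_right h1.2 _).trans ?_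
  rw [← ENNReal.ofReal_mul (by positivity)]
  apply le_of_eq; congr 1; rw [pow_add]; field_simp

theorem IsL2LittleO.congr (hh : IsL2LittleO h x k)
    (he : ∀ᶠ r in 𝓝[>] (0 : ℝ), ∀ᵐ y ∂(unifBall x r), h y = h' y) : IsL2LittleO h' x k := by
  intro ε hε
  filter_upwards [hh ε hε, he] with r h1 h2
  exact ⟨h1.1.congr h2, (eLpNorm_congr_ae h2) ▸ h1.2⟩

theorem IsL2LittleO.sub (hh : IsL2LittleO h x k) (hh' : IsL2LittleO h' x k) :
    IsL2LittleO (fun y => h y - h' y) x k := by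
  have h2 : IsL2LittleO (fun y => - h' y) x k := by
    have := hh'.of_bound (g := fun y => - h' y)
      (hh'.eventually_aestronglyMeasurable.mono fun _ hr => hr.neg) 1 0 (by simp)
    simpa using this
  simpa only [← sub_eq_add_neg] using hh.add h2

theorem eventually_ball_mul_subset {Ω : Set (EuclideanSpace ℝ (Fin d))} (hΩ : IsOpen Ω) (hx : x ∈ Ω)
    (c : ℝ) : ∀ᶠ r in 𝓝[>] (0 : ℝ), ball x (c * r) ⊆ Ω := by
  obtain ⟨ε, hε, hb⟩ := Metric.isOpen_iff.1 hΩ x hx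
  have : Tendsto (fun r : ℝ => c * r) (𝓝[>] 0) (𝓝 0) := by
    have : Tendsto (fun r : ℝ => c * r) (𝓝 0) (𝓝 (c * 0)) := tendsto_id.const_mul c
    rw [mul_zero] at this
    exact this.mono_left nhdsWithin_le_nhds
  filter_upwards [this.eventually_lt_const hε] with r hr
  exact (ball_subset_ball hr.le).trans hb

theorem eventually_ae_unifBall {Ω : Set (EuclideanSpace ℝ (Fin d))} (hΩ : IsOpen Ω) (hx : x ∈ Ω)
    {p : EuclideanSpace ℝ (Fin d) → Prop} (hp : ∀ᵐ y ∂(volume.restrict Ω), p y) :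
    ∀ᶠ r in 𝓝[>] (0 : ℝ), ∀ᵐ y ∂(unifBall x r), p y := by
  filter_upwards [eventually_ball_mul_subset hΩ hx 1] with r hr
  rw [one_mul] at hr
  exact (unifBall_absolutelyContinuous x r).ae_le (ae_restrict_of_ae_restrict_of_subset hr hp)

theorem eventually_aestronglyMeasurable_unifBall {Ω : Set (EuclideanSpace ℝ (Fin d))}
    (hΩ : IsOpen Ω) (hx : x ∈ Ω) (hh : AEStronglyMeasurable h (volume.restrict Ω)) :
    ∀ᶠ r in 𝓝[>] (0 : ℝ), AEStronglyMeasurable h (unifBall x r) := by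
  filter_upwards [eventually_ball_mul_subset hΩ hx 1] with r hr
  rw [one_mul] at hr
  exact (hh.mono_measure (Measure.restrict_mono hr le_rfl)).mono_ac
    (unifBall_absolutelyContinuous x r)

/-- Almost every point is a Lebesgue point in the mean of order two. -/
theorem ae_isL2LittleO_sub [SecondCountableTopology V] {g : EuclideanSpace ℝ (Fin d) → V}
    (hg : ∀ K : Set (EuclideanSpace ℝ (Fin d)), IsCompact K → MemLp g 2 (volume.restrict K)) :
    ∀ᵐ x, IsL2LittleO (fun y => g y - g x) x 0 := by
  have hK : ∀ (K : Set (EuclideanSpace ℝ (Fin d))), IsCompact K → ∀ q : V,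
      MemLp (fun y => g y - q) 2 (volume.restrict K) := fun K hK q => by
    have : IsFiniteMeasure (volume.restrict K) := ⟨by simpa using hK.measure_lt_top⟩
    exact (hg K hK).sub (memLp_const q)
  have hloc : ∀ q : V, LocallyIntegrable (fun y => ‖g y - q‖ ^ 2) := fun q => by
    rw [locallyIntegrable_iff]
    exact fun K hK' => (hK K hK' q).integrable_norm_pow two_ne_zero
  -- The null set in Lebesgue differentiation depends on the constant subtracted, so only a
  -- countable dense family of constants is used; `g x` is then approximated by one of them.
  have hae : ∀ᵐ x, ∀ m : ℕ, Tendsto (fun r => ⨍ y in closedBall x r,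
      ‖g y - TopologicalSpace.denseSeq V m‖ ^ 2) (𝓝[>] 0)
      (𝓝 (‖g x - TopologicalSpace.denseSeq V m‖ ^ 2)) := by
    refine ae_all_iff.2 fun m => ?_
    filter_upwards [(Besicovitch.vitaliFamily volume).ae_tendsto_average
      (hloc (TopologicalSpace.denseSeq V m))] with x hx
    exact hx.comp (Besicovitch.tendsto_filterAt volume x)
  filter_upwards [hae] with x hx ε hε
  obtain ⟨m, hm⟩ := (TopologicalSpace.denseRange_denseSeq V).exists_dist_lt (g x)
    (show 0 < ε / 4 by positivity)
  set q := TopologicalSpace.denseSeq V m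
  rw [dist_eq_norm] at hm
  have h1 := (hx m).eventually_lt_const (u := (ε / 2) ^ 2)
    (pow_lt_pow_left₀ (by linarith) (norm_nonneg _) two_ne_zero)
  filter_upwards [h1, self_mem_nhdsWithin] with r hr hr0
  have hr0 : 0 < r := hr0
  have := isProbabilityMeasure_unifBall x hr0
  have hmem : MemLp (fun y => g y - q) 2 (unifBall x r) :=
    ((hK _ (isCompact_closedBall x r) q).mono_measure
      (Measure.restrict_mono ball_subset_closedBall le_rfl)).smul_measure
      (ENNReal.inv_ne_top.2 (measure_ball_pos _ _ hr0).ne')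
  have hge : AEStronglyMeasurable (fun y => g y - g x) (unifBall x r) := by
    have := hmem.1.add (aestronglyMeasurable_const (b := q - g x))
    simpa [Pi.add_def] using this
  refine ⟨hge, ?_⟩
  have h2 : eLpNorm (fun y => g y - q) 2 (unifBall x r) ≤ ENNReal.ofReal (ε / 2) := by
    rw [← ENNReal.pow_le_pow_left_iff two_ne_zero, eLpNorm_two_sq]
    have h3 : ∫⁻ y, ‖g y - q‖ₑ ^ 2 ∂(unifBall x r)
        = ENNReal.ofReal (∫ y, ‖g y - q‖ ^ 2 ∂(unifBall x r)) := by
      rw [ofReal_integral_eq_lintegral_ofReal (hmem.integrable_norm_pow two_ne_zero)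
        (Eventually.of_forall fun y => by positivity)]
      simp only [ENNReal.ofReal_pow (norm_nonneg _), ofReal_norm]
    rw [h3, integral_unifBall, ← ENNReal.ofReal_pow (by positivity)]
    refine ENNReal.ofReal_le_ofReal (le_of_eq_of_le ?_ hr.le)
    -- The differentiation theorem averages over closed balls; spheres are null.
    refine setAverage_congr (ae_eq_of_subset_of_measure_ge ball_subset_closedBall ?_
      measurableSet_ball.nullMeasurableSet measure_closedBall_lt_top.ne)
    rw [Measure.addHaar_closedBall _ _ hr0.le, Measure.addHaar_ball_of_pos _ _ hr0]
  have h4 : eLpNorm (fun y => g y - g x) 2 (unifBall x r) ≤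
      eLpNorm (fun y => g y - q) 2 (unifBall x r) +
        eLpNorm (fun _ => q - g x) 2 (unifBall x r) := by
    refine le_of_eq_of_le ?_ (eLpNorm_add_le hmem.1 aestronglyMeasurable_const one_le_two)
    congr 1 with y
    simp
  refine h4.trans ((add_le_add h2 (d := ENNReal.ofReal (ε / 4)) ?_).trans ?_)
  · rw [eLpNorm_const _ two_ne_zero (NeZero.ne _), measure_univ, ENNReal.one_rpow, mul_one,
      ← ofReal_norm, norm_sub_rev]
    exact ENNReal.ofReal_le_ofReal hm.le
  · rw [← ENNReal.ofReal_add (by positivity) (by positivity)]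
    exact ENNReal.ofReal_le_ofReal (by simp; linarith)

theorem ae_restrict_isL2LittleO_sub [SecondCountableTopology V]
    {Ω : Set (EuclideanSpace ℝ (Fin d))} (hΩ : IsOpen Ω)
    {g : EuclideanSpace ℝ (Fin d) → V} {p : ℝ≥0∞} (hp : 2 ≤ p)
    (hg : MemLp g p (volume.restrict Ω)) :
    ∀ᵐ x ∂(volume.restrict Ω), IsL2LittleO (fun y => g y - g x) x 0 := by
  have h1 : MemLp (Ω.indicator g) p volume := (memLp_indicator_iff_restrict hΩ.measurableSet).2 hg
  have h2 := ae_isL2LittleO_sub (g := Ω.indicator g) fun K hK => by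
    have : IsFiniteMeasure (volume.restrict K) := ⟨by simpa using hK.measure_lt_top⟩
    exact (h1.mono_measure Measure.restrict_le_self).mono_exponent hp
  filter_upwards [ae_restrict_of_ae h2, ae_restrict_mem hΩ.measurableSet] with x hx hxΩ
  refine hx.congr ?_
  filter_upwards [eventually_ae_unifBall hΩ hxΩ (ae_restrict_mem hΩ.measurableSet)] with r hr
  filter_upwards [hr] with y hy
  rw [Set.indicator_of_mem hy, Set.indicator_of_mem hxΩ]

end

/-! ### Dyadic summation and mean-square differentiability of H¹ functions -/

/-- Iterating the halving step sums c r (1 + 1/2 + 1/4 + ...) = 2 c r, while the leftover `N (r / 2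
^ m)` tends to zero. -/
theorem le_ofReal_of_le_add_half {N : ℝ → ℝ≥0∞} {c r₀ : ℝ} (hc : 0 ≤ c)
    (hN : ∀ ε : ℝ, 0 < ε → ∀ᶠ r in 𝓝[>] (0 : ℝ), N r ≤ ENNReal.ofReal ε)
    (hstep : ∀ r, 0 < r → r < r₀ → N r ≤ ENNReal.ofReal (c * r) + N (r / 2)) {r : ℝ} (hr : 0 < r)
    (hr₀ : r < r₀) : N r ≤ ENNReal.ofReal (2 * c * r) := by
  have hpos : ∀ m : ℕ, 0 < r / 2 ^ m := fun m => by positivity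
  have hle : ∀ m : ℕ, r / 2 ^ m ≤ r := fun m => div_le_self hr.le (one_le_pow₀ one_le_two)
  have key : ∀ m : ℕ, N r ≤ ENNReal.ofReal (2 * c * (r - r / 2 ^ m)) + N (r / 2 ^ m) := by
    intro m
    induction m with
    | zero => simp
    | succ m ih =>
      have h1 := hstep _ (hpos m) ((hle m).trans_lt hr₀)
      have h2 : r / 2 ^ m / 2 = r / 2 ^ (m + 1) := by rw [pow_succ, div_div]
      rw [h2] at h1
      refine ih.trans ((add_le_add_right h1 _).trans ?_)
      rw [← add_assoc, ← ENNReal.ofReal_add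
        (mul_nonneg (by positivity) (sub_nonneg.2 (hle m))) (mul_nonneg hc (hpos m).le)]
      gcongr
      apply le_of_eq; rw [← h2]; ring
  have hlim : Tendsto (fun m : ℕ => r / 2 ^ m) atTop (𝓝[>] 0) := by
    refine tendsto_nhdsWithin_iff.2 ⟨?_, Eventually.of_forall hpos⟩
    exact tendsto_const_nhds.div_atTop (tendsto_pow_atTop_atTop_of_one_lt one_lt_two)
  refine ENNReal.le_of_forall_pos_le_add fun ε hε _ => ?_
  obtain ⟨m, hm⟩ := (hlim.eventually (hN ε (NNReal.coe_pos.2 hε))).exists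
  refine (key m).trans (add_le_add (ENNReal.ofReal_le_ofReal ?_) (by simpa using hm))
  exact mul_le_mul_of_nonneg_left (by linarith [hpos m]) (by positivity)

section
variable {d : ℕ} {V : Type*} [NormedAddCommGroup V] [NormedSpace ℝ V] [CompleteSpace V]
  {Ω : Set (EuclideanSpace ℝ (Fin d))} {u : EuclideanSpace ℝ (Fin d) → V}
  {G : EuclideanSpace ℝ (Fin d) → (EuclideanSpace ℝ (Fin d) →L[ℝ] V)}

theorem HasWeakDeriv.eLpNorm_sub_prod_le (hw : HasWeakDeriv Ω u G) (hΩ : IsOpen Ω)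
    (hu : LocallyIntegrable (Ω.indicator u)) (A : EuclideanSpace ℝ (Fin d) →L[ℝ] V)
    {x : EuclideanSpace ℝ (Fin d)} {r : ℝ} (hr : 0 < r) (hxΩ : ball x (4 * r) ⊆ Ω) :
    eLpNorm (fun p : EuclideanSpace ℝ (Fin d) × EuclideanSpace ℝ (Fin d) =>
        (u p.1 - A p.1) - (u p.2 - A p.2)) 2 ((unifBall x r).prod (unifBall x r)) ≤
      ENNReal.ofReal (2 * 8 ^ d * r) * eLpNorm (fun y => G y - A) 2 (unifBall x (4 * r)) := by
  have := isProbabilityMeasure_unifBall x hr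
  have hsub : ball x r ⊆ Ω := (ball_subset_ball (by linarith)).trans hxΩ
  have hum : AEStronglyMeasurable (fun y => u y - A y) (unifBall x r) :=
    ((hw.1.aestronglyMeasurable.mono_measure (Measure.restrict_mono hsub le_rfl)).mono_ac
      (unifBall_absolutelyContinuous x r)).sub A.continuous.aestronglyMeasurable
  have hpm : AEMeasurable (fun p : EuclideanSpace ℝ (Fin d) × EuclideanSpace ℝ (Fin d) =>
      ‖(u p.1 - A p.1) - (u p.2 - A p.2)‖ₑ ^ 2) ((unifBall x r).prod (unifBall x r)) :=
    (hum.comp_fst.sub hum.comp_snd).enorm.pow_const 2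
  rw [← ENNReal.pow_le_pow_left_iff two_ne_zero, mul_pow, eLpNorm_two_sq, eLpNorm_two_sq,
    lintegral_prod_symm _ hpm]
  simp only [lintegral_unifBall]
  set m := volume (ball x r) with hm
  have hm0 : m ≠ 0 := (measure_ball_pos _ _ hr).ne'
  have hmt : m ≠ ⊤ := measure_ball_lt_top.ne
  rw [lintegral_const_mul' _ _ (ENNReal.inv_ne_top.2 hm0)]
  have h1 := hw.lintegral_lintegral_enorm_sub_sq_le hΩ hu A hr hxΩ
  have h4 : volume (ball x (4 * r)) = ENNReal.ofReal (4 ^ d) * m :=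
    volume_ball_mul x x (by norm_num) r
  rw [volume_ball_mul 0 x two_pos r, ← hm] at h1
  rw [h4]
  set I := ∫⁻ w in ball x (4 * r), ‖G w - A‖ₑ ^ 2
  have h4' : I = ENNReal.ofReal (4 ^ d) * m * ((ENNReal.ofReal (4 ^ d) * m)⁻¹ * I) := by
    rw [← mul_assoc, ENNReal.mul_inv_cancel, one_mul]
    · exact mul_ne_zero (by simp) hm0
    · exact ENNReal.mul_ne_top (by simp) hmt
  set J := (ENNReal.ofReal (4 ^ d) * m)⁻¹ * I
  calc _ ≤ m⁻¹ * (m⁻¹ * (ENNReal.ofReal (2 ^ d) * m * (ENNReal.ofReal (2 * r) ^ 2 * I))) := by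
        gcongr
    _ = m⁻¹ * (m⁻¹ * (ENNReal.ofReal (2 ^ d) * m * (ENNReal.ofReal (2 * r) ^ 2 *
          (ENNReal.ofReal (4 ^ d) * m * J)))) := by rw [← h4']
    _ = (m⁻¹ * m) * (m⁻¹ * m) * (ENNReal.ofReal (2 ^ d) * ENNReal.ofReal (2 * r) ^ 2 *
          ENNReal.ofReal (4 ^ d)) * J := by ring
    _ = ENNReal.ofReal (2 ^ d * (2 * r) ^ 2 * 4 ^ d) * J := by
        rw [ENNReal.inv_mul_cancel hm0 hmt, one_mul, one_mul, ← ENNReal.ofReal_pow (by positivity),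
          ← ENNReal.ofReal_mul (by positivity), ← ENNReal.ofReal_mul (by positivity)]
    -- Only a dimensional constant matters: 2^d · 4^d = 8^d is enlarged to (8^d)² so that the square
    -- root is clean.
    _ ≤ _ := by
        gcongr
        rw [← ENNReal.ofReal_pow (by positivity)]
        refine ENNReal.ofReal_le_ofReal ?_
        have e1 : (2 : ℝ) ^ d * 4 ^ d = 8 ^ d := by rw [← mul_pow]; norm_num
        have e2 : (1 : ℝ) ≤ 8 ^ d := one_le_pow₀ (by norm_num)
        calc (2 : ℝ) ^ d * (2 * r) ^ 2 * 4 ^ d = (2 * r) ^ 2 * (8 ^ d * 1) := by rw [← e1]; ring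
          _ ≤ (2 * r) ^ 2 * (8 ^ d * 8 ^ d) := by gcongr
          _ = _ := by ring

/-- Minkowski on B_r × B_{r/2}: f(y) - b = (f(y) - f(z)) + (f(z) - b). The first term is an
oscillation, bounded on B_r × B_r at the cost of a doubling factor. -/
theorem HasWeakDeriv.eLpNorm_sub_le_add_half (hw : HasWeakDeriv Ω u G) (hΩ : IsOpen Ω)
    (hu : LocallyIntegrable (Ω.indicator u)) (A : EuclideanSpace ℝ (Fin d) →L[ℝ] V) (b : V)
    {x : EuclideanSpace ℝ (Fin d)} {r : ℝ} (hr : 0 < r) (hxΩ : ball x (4 * r) ⊆ Ω) :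
    eLpNorm (fun y => (u y - A y) - b) 2 (unifBall x r) ≤
      2 ^ d * (ENNReal.ofReal (2 * 8 ^ d * r) *
        eLpNorm (fun y => G y - A) 2 (unifBall x (4 * r))) +
      eLpNorm (fun y => (u y - A y) - b) 2 (unifBall x (r / 2)) := by
  have := isProbabilityMeasure_unifBall x hr
  have := isProbabilityMeasure_unifBall x (half_pos hr)
  have hum : ∀ ρ ≤ r, AEStronglyMeasurable (fun y => u y - A y) (unifBall x ρ) := fun ρ hρ =>
    ((hw.1.aestronglyMeasurable.mono_measure (Measure.restrict_mono
      ((ball_subset_ball (by linarith)).trans hxΩ) le_rfl)).mono_ac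
      (unifBall_absolutelyContinuous x ρ)).sub A.continuous.aestronglyMeasurable
  have hr' := hum r le_rfl
  have hr2 := hum (r / 2) (by linarith)
  have hb : ∀ ρ ≤ r, AEStronglyMeasurable (fun y => u y - A y - b) (unifBall x ρ) := fun ρ hρ =>
    (hum ρ hρ).sub aestronglyMeasurable_const
  have hb2 := hb (r / 2) (by linarith)
  have h1 := eLpNorm_comp_measurePreserving (p := 2) (hb r le_rfl)
    (measurePreserving_fst (μ := unifBall x r) (ν := unifBall x (r / 2)))
  have h2 := eLpNorm_comp_measurePreserving (p := 2) hb2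
    (measurePreserving_snd (μ := unifBall x r) (ν := unifBall x (r / 2)))
  have h3 := eLpNorm_add_le (p := 2) (hr'.comp_fst.sub hr2.comp_snd)
    (hb2.comp_snd (μ := unifBall x r)) one_le_two
  have h4 : (unifBall x r).prod (unifBall x (r / 2)) ≤
      (2 : ℝ≥0∞) ^ d • (unifBall x r).prod (unifBall x r) := by
    rw [← Measure.prod_smul_right]
    exact Measure.prod_mono le_rfl (unifBall_half_le x hr)
  have h5 : eLpNorm (fun p : EuclideanSpace ℝ (Fin d) × EuclideanSpace ℝ (Fin d) =>
      (u p.1 - A p.1) - (u p.2 - A p.2)) 2 ((unifBall x r).prod (unifBall x (r / 2))) ≤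
      2 ^ d * eLpNorm (fun p : EuclideanSpace ℝ (Fin d) × EuclideanSpace ℝ (Fin d) =>
        (u p.1 - A p.1) - (u p.2 - A p.2)) 2 ((unifBall x r).prod (unifBall x r)) := by
    refine (eLpNorm_mono_measure _ h4).trans ?_
    rw [eLpNorm_smul_measure_of_ne_top (by simp), smul_eq_mul]
    gcongr
    refine (ENNReal.rpow_le_rpow_of_exponent_le (one_le_pow₀ one_le_two) (z := 1) ?_).trans_eq
      (ENNReal.rpow_one _)
    norm_num
  have h6 := hw.eLpNorm_sub_prod_le hΩ hu A hr hxΩ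
  simp only [Function.comp_def] at h1 h2
  rw [← h1, ← h2]
  refine le_trans (le_of_eq ?_) (h3.trans (add_le_add (h5.trans (by gcongr)) le_rfl))
  congr 1 with p
  simp

/-- A function in `H¹` is differentiable in the mean of order two at almost every point, with its
weak derivative as the derivative. -/
theorem HasWeakDeriv.ae_isL2LittleO [FiniteDimensional ℝ V] (hw : HasWeakDeriv Ω u G)
    (hΩ : IsOpen Ω) (hu : MemLp u 2 (volume.restrict Ω)) (hG : MemLp G 2 (volume.restrict Ω)) :
    ∀ᵐ x ∂(volume.restrict Ω), IsL2LittleO (fun y => u y - u x - G x (y - x)) x 1 := by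
  have : ProperSpace V := FiniteDimensional.proper ℝ V
  have : ProperSpace (EuclideanSpace ℝ (Fin d) →L[ℝ] V) := FiniteDimensional.proper ℝ _
  have hui : LocallyIntegrable (Ω.indicator u) :=
    ((memLp_indicator_iff_restrict hΩ.measurableSet).2 hu).locallyIntegrable one_le_two
  filter_upwards [ae_restrict_isL2LittleO_sub hΩ le_rfl hu, ae_restrict_isL2LittleO_sub hΩ le_rfl hG,
    ae_restrict_mem hΩ.measurableSet] with x hxu hxG hxΩ
  have hmeas : ∀ᶠ r in 𝓝[>] (0 : ℝ),
      AEStronglyMeasurable (fun y => u y - u x - G x (y - x)) (unifBall x r) := by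
    filter_upwards [hxu.eventually_aestronglyMeasurable] with r hr
    exact hr.sub (by fun_prop : Continuous fun y => G x (y - x)).aestronglyMeasurable
  have heq : ∀ r, eLpNorm (fun y => (u y - G x y) - (u x - G x x)) 2 (unifBall x r)
      = eLpNorm (fun y => u y - u x - G x (y - x)) 2 (unifBall x r) := by
    intro r
    congr 1 with y
    rw [map_sub]; abel
  -- Qualitative decay of the remainder, which removes the leftover term in the dyadic iteration.
  have hzero : ∀ ε : ℝ, 0 < ε → ∀ᶠ r in 𝓝[>] (0 : ℝ),
      eLpNorm (fun y => u y - u x - G x (y - x)) 2 (unifBall x r) ≤ ENNReal.ofReal ε := by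
    intro ε hε
    have hsmall : ∀ᶠ r in 𝓝[>] (0 : ℝ), (‖G x‖ + 1) * r < ε / 2 := by
      have : Tendsto (fun r : ℝ => (‖G x‖ + 1) * r) (𝓝 0) (𝓝 ((‖G x‖ + 1) * 0)) :=
        tendsto_id.const_mul _
      rw [mul_zero] at this
      exact (this.mono_left nhdsWithin_le_nhds).eventually_lt_const (half_pos hε)
    filter_upwards [hxu (ε / 2) (half_pos hε), hsmall, self_mem_nhdsWithin] with r h1 h2 h3
    have h3 : 0 < r := h3
    have := isProbabilityMeasure_unifBall x h3
    have h4 : eLpNorm (fun y => G x (y - x)) 2 (unifBall x r) ≤ ENNReal.ofReal (ε / 2) := by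
      refine (eLpNorm_le_of_ae_bound (C := ε / 2) ?_).trans (by simp)
      filter_upwards [ae_unifBall_mem x r] with y hy
      rw [mem_ball, dist_eq_norm] at hy
      refine ((G x).le_opNorm _).trans (le_trans ?_ h2.le)
      exact mul_le_mul (by linarith) hy.le (norm_nonneg _) (by positivity)
    refine (eLpNorm_sub_le h1.1
      (by fun_prop : Continuous fun y => G x (y - x)).aestronglyMeasurable one_le_two).trans ?_
    refine (add_le_add h1.2 h4).trans ?_
    rw [← ENNReal.ofReal_add (by positivity) (by positivity)]
    exact ENNReal.ofReal_le_ofReal (by simp)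
  intro ε hε
  -- Chosen so that each halving step costs ε r / 2; the geometric sum doubles this to ε r.
  set C : ℝ := 2 * (2 ^ d * (2 * 8 ^ d)) with hC
  have hCpos : 0 < C := by positivity
  have h4r : Tendsto (fun r : ℝ => 4 * r) (𝓝[>] 0) (𝓝[>] 0) := by
    refine tendsto_nhdsWithin_iff.2 ⟨?_, ?_⟩
    · have : Tendsto (fun r : ℝ => 4 * r) (𝓝 0) (𝓝 (4 * 0)) := tendsto_id.const_mul 4
      rw [mul_zero] at this
      exact this.mono_left nhdsWithin_le_nhds
    · filter_upwards [self_mem_nhdsWithin] with r hr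
      exact mul_pos four_pos (Set.mem_Ioi.1 hr)
  have hev := (h4r.eventually (hxG (ε / C) (by positivity))).and
    (eventually_ball_mul_subset hΩ hxΩ 4)
  obtain ⟨r₀, hr₀, hev⟩ := mem_nhdsGT_iff_exists_Ioo_subset.1 hev
  have hr₀ : 0 < r₀ := hr₀
  have hstep : ∀ r, 0 < r → r < r₀ →
      eLpNorm (fun y => u y - u x - G x (y - x)) 2 (unifBall x r) ≤
        ENNReal.ofReal (ε / 2 * r) +
        eLpNorm (fun y => u y - u x - G x (y - x)) 2 (unifBall x (r / 2)) := by
    intro r hr hrr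
    obtain ⟨⟨-, h1⟩, h2⟩ := hev ⟨hr, hrr⟩
    have h3 := hw.eLpNorm_sub_le_add_half hΩ hui (G x) (u x - G x x) hr h2
    rw [heq, heq] at h3
    refine h3.trans (add_le_add ?_ le_rfl)
    calc _ ≤ (2 : ℝ≥0∞) ^ d * (ENNReal.ofReal (2 * 8 ^ d * r) *
          ENNReal.ofReal (ε / C * (4 * r) ^ 0)) := by gcongr
      _ = ENNReal.ofReal (2 ^ d * (2 * 8 ^ d * r * (ε / C * (4 * r) ^ 0))) := by
        rw [← ENNReal.ofReal_mul (by positivity),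
          ENNReal.ofReal_mul (p := 2 ^ d) (by positivity), ENNReal.ofReal_pow zero_le_two,
          ENNReal.ofReal_ofNat]
      _ ≤ _ := by
        refine ENNReal.ofReal_le_ofReal (le_of_eq ?_)
        rw [hC]; field_simp
  filter_upwards [hmeas, Ioo_mem_nhdsGT hr₀] with r h1 h2
  refine ⟨h1, ?_⟩
  have := le_ofReal_of_le_add_half (half_pos hε).le hzero hstep h2.1 h2.2
  refine this.trans (le_of_eq ?_)
  congr 1; ring

end

/-! ### Uniqueness of weak derivatives and of L²-gradients -/

section
variable {d : ℕ} {V : Type*} [NormedAddCommGroup V] [NormedSpace ℝ V]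
  {Ω : Set (EuclideanSpace ℝ (Fin d))} {x : EuclideanSpace ℝ (Fin d)}

/-- The fundamental lemma of the calculus of variations in each basis direction. It transfers
results from the square-integrable derivatives provided by `MemH1` to arbitrary weak derivatives. -/
theorem HasWeakDeriv.ae_eq [CompleteSpace V] {f : EuclideanSpace ℝ (Fin d) → V}
    {G G' : EuclideanSpace ℝ (Fin d) → (EuclideanSpace ℝ (Fin d) →L[ℝ] V)} (hΩ : IsOpen Ω)
    (hG : HasWeakDeriv Ω f G) (hG' : HasWeakDeriv Ω f G') :
    ∀ᵐ x ∂(volume.restrict Ω), G x = G' x := by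
  have hloc : ∀ v : EuclideanSpace ℝ (Fin d), LocallyIntegrableOn (fun x => G x v - G' x v) Ω := by
    intro v y hy
    obtain ⟨t, ht, h1⟩ := (hG.2.1.sub hG'.2.1) y hy
    exact ⟨t, ht, h1.apply_continuousLinearMap v⟩
  have hv : ∀ v : EuclideanSpace ℝ (Fin d), ∀ᵐ x, x ∈ Ω → G x v - G' x v = 0 := by
    intro v
    refine hΩ.ae_eq_zero_of_integral_contDiff_smul_eq_zero (hloc v) fun φ hφ hc hs => ?_
    have h1 := hG.2.2 φ hφ hc hs v
    rw [hG'.2.2 φ hφ hc hs v, neg_inj] at h1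
    rw [← setIntegral_eq_integral_of_forall_compl_eq_zero (s := Ω)]
    · have hi := hG.2.1.integrableOn_smul_of_tsupport_subset hφ.continuous hc hs
      have hi' := hG'.2.1.integrableOn_smul_of_tsupport_subset hφ.continuous hc hs
      simp only [smul_sub]
      rw [integral_sub, h1, sub_self]
      · exact hi.apply_continuousLinearMap v
      · exact hi'.apply_continuousLinearMap v
    · intro y hy
      rw [image_eq_zero_of_notMem_tsupport fun h => hy (hs h), zero_smul]
  have hall : ∀ᵐ x, ∀ i : Fin d, x ∈ Ω → G x (EuclideanSpace.basisFun (Fin d) ℝ i)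
      - G' x (EuclideanSpace.basisFun (Fin d) ℝ i) = 0 := ae_all_iff.2 fun i => hv _
  rw [ae_restrict_iff' hΩ.measurableSet]
  filter_upwards [hall] with y hy hyΩ
  refine ContinuousLinearMap.coe_injective
    ((EuclideanSpace.basisFun (Fin d) ℝ).toBasis.ext fun i => ?_)
  simpa [sub_eq_zero] using hy i hyΩ

/-- If L w ≠ 0 with |w| = 1/2, then |L(y - x)| ≥ r|L w|/2 on a ball of radius δr around x + r w.
This ball fills the fixed fraction δ^d of B_r, so the mean square is at least κ r². -/
theorem IsL2LittleO.linear_eq_zero {L : EuclideanSpace ℝ (Fin d) →L[ℝ] V}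
    (hL : IsL2LittleO (fun y => L (y - x)) x 1) : L = 0 := by
  by_contra hne
  obtain ⟨v, hv⟩ : ∃ v, L v ≠ 0 := by
    by_contra! h
    exact hne (ContinuousLinearMap.ext h)
  have hv0 : v ≠ 0 := fun h => hv (by rw [h, map_zero])
  have hvn : 0 < ‖v‖ := norm_pos_iff.2 hv0
  set w : EuclideanSpace ℝ (Fin d) := (2 * ‖v‖)⁻¹ • v with hw
  have hwn : ‖w‖ = 1 / 2 := by
    rw [hw, norm_smul, Real.norm_of_nonneg (by positivity)]; field_simp
  have hLw : 0 < ‖L w‖ := by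
    rw [norm_pos_iff, hw, map_smul]
    exact smul_ne_zero (by positivity) hv
  -- The first bound keeps the small ball inside B_r; the second limits the variation of L there to
  -- r‖L w‖/2.
  set δ : ℝ := min (1 / 2) (‖L w‖ / 2 / (‖L‖ + 1)) with hδ
  have hδ0 : 0 < δ := lt_min (by norm_num) (by positivity)
  have hδ1 : δ ≤ 1 / 2 := min_le_left _ _
  have hδ2 : (‖L‖ + 1) * δ ≤ ‖L w‖ / 2 := by
    have := min_le_right (1 / 2) (‖L w‖ / 2 / (‖L‖ + 1))
    rwa [← hδ, le_div_iff₀ (by positivity), mul_comm] at this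
  set κ : ℝ := δ ^ d * (‖L w‖ / 2) ^ 2 with hκ
  have hκ0 : 0 < κ := by positivity
  obtain ⟨r, ⟨-, h1⟩, hr⟩ := ((hL (Real.sqrt (κ / 2)) (by positivity)).and
    self_mem_nhdsWithin).exists
  have hr : 0 < r := hr
  rw [← ENNReal.pow_le_pow_left_iff two_ne_zero, eLpNorm_two_sq, lintegral_unifBall,
    ← ENNReal.ofReal_pow (by positivity), pow_one, mul_pow, Real.sq_sqrt (by positivity)] at h1
  have hsub : ball (x + r • w) (δ * r) ⊆ ball x r := by
    refine ball_subset_ball' ?_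
    rw [dist_eq_norm, add_sub_cancel_left, norm_smul, hwn, Real.norm_of_nonneg hr.le]
    nlinarith
  have hlow : ∀ y ∈ ball (x + r • w) (δ * r),
      ENNReal.ofReal (r ^ 2 * (‖L w‖ / 2) ^ 2) ≤ ‖L (y - x)‖ₑ ^ 2 := by
    intro y hy
    rw [mem_ball, dist_eq_norm] at hy
    rw [← ofReal_norm, ← ENNReal.ofReal_pow (norm_nonneg _), ← mul_pow]
    refine ENNReal.ofReal_le_ofReal (pow_le_pow_left₀ (by positivity) ?_ 2)
    have e1 : L (y - x) = r • L w + L (y - (x + r • w)) := by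
      rw [← map_smul, ← map_add]; congr 1; abel
    have e2 : ‖L (y - (x + r • w))‖ ≤ r * (‖L w‖ / 2) := by
      calc _ ≤ ‖L‖ * ‖y - (x + r • w)‖ := L.le_opNorm _
        _ ≤ (‖L‖ + 1) * (δ * r) := by gcongr; linarith
        _ = r * ((‖L‖ + 1) * δ) := by ring
        _ ≤ _ := by gcongr
    have e3 : ‖r • L w‖ = r * ‖L w‖ := by rw [norm_smul, Real.norm_of_nonneg hr.le]
    have e4 := norm_sub_le_norm_add (r • L w) (L (y - (x + r • w)))
    rw [e1]; linarith
  set m := volume (ball x r) with hm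
  have hm0 : m ≠ 0 := (measure_ball_pos _ _ hr).ne'
  have hmt : m ≠ ⊤ := measure_ball_lt_top.ne
  have h2 : ENNReal.ofReal (κ * r ^ 2) ≤ m⁻¹ * ∫⁻ y in ball x r, ‖L (y - x)‖ₑ ^ 2 := by
    calc ENNReal.ofReal (κ * r ^ 2)
        = (m⁻¹ * m) * (ENNReal.ofReal (r ^ 2 * (‖L w‖ / 2) ^ 2) * ENNReal.ofReal (δ ^ d)) := by
          rw [ENNReal.inv_mul_cancel hm0 hmt, one_mul, ← ENNReal.ofReal_mul (by positivity), hκ]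
          congr 1; ring
      _ = m⁻¹ * (ENNReal.ofReal (r ^ 2 * (‖L w‖ / 2) ^ 2) *
            volume (ball (x + r • w) (δ * r))) := by
          rw [volume_ball_mul _ x hδ0 r, ← hm]; ring
      _ = m⁻¹ * ∫⁻ _ in ball (x + r • w) (δ * r),
            ENNReal.ofReal (r ^ 2 * (‖L w‖ / 2) ^ 2) := by rw [setLIntegral_const]
      _ ≤ m⁻¹ * ∫⁻ y in ball (x + r • w) (δ * r), ‖L (y - x)‖ₑ ^ 2 := by
          gcongr m⁻¹ * ?_
          exact setLIntegral_mono' measurableSet_ball hlow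
      _ ≤ _ := by
          gcongr m⁻¹ * ?_
          exact lintegral_mono_set hsub
  have h3 := (ENNReal.ofReal_le_ofReal_iff (by positivity)).1 (h2.trans h1)
  have : 0 < κ * r ^ 2 := by positivity
  linarith

theorem MeasureTheory.MemLp.eLpNorm_two_sq_eq_ofReal_integral {α W : Type*} [MeasurableSpace α]
    {μ : Measure α} [NormedAddCommGroup W] {h : α → W} (hh : MemLp h 2 μ) :
    eLpNorm h 2 μ ^ 2 = ENNReal.ofReal (∫ a, ‖h a‖ ^ 2 ∂μ) := by
  rw [eLpNorm_two_sq, ofReal_integral_eq_lintegral_ofReal (hh.integrable_norm_pow two_ne_zero)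
    (Eventually.of_forall fun y => by positivity)]
  simp only [ENNReal.ofReal_pow (norm_nonneg _), ofReal_norm]

theorem memLp_unifBall_iff {W : Type*} [NormedAddCommGroup W] {h : EuclideanSpace ℝ (Fin d) → W}
    {r : ℝ} (hr : 0 < r) :
    MemLp h 2 (unifBall x r) ↔ MemLp h 2 (volume.restrict (ball x r)) := by
  have hm0 : volume (ball x r) ≠ 0 := (measure_ball_pos _ _ hr).ne'
  have hmt : volume (ball x r) ≠ ⊤ := measure_ball_lt_top.ne
  refine ⟨fun hh => ?_, fun hh => hh.smul_measure (ENNReal.inv_ne_top.2 hm0)⟩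
  have h1 := hh.smul_measure hmt
  rwa [unifBall, smul_smul, ENNReal.mul_inv_cancel hm0 hmt, one_smul] at h1

variable {n : EuclideanSpace ℝ (Fin d) → EuclideanSpace ℝ (Fin d)}
  {A B : EuclideanSpace ℝ (Fin d) →L[ℝ] EuclideanSpace ℝ (Fin d)}

theorem hasL2GradientAt_iff :
    HasL2GradientAt n A x ↔ IsL2LittleO (fun y => n y - n x - A (y - x)) x 1 := by
  constructor
  · rintro ⟨h1, h2⟩ ε hε
    filter_upwards [h1, isLittleO_iff.1 h2 (show 0 < ε ^ 2 by positivity), self_mem_nhdsWithin]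
      with r h3 h4 hr
    have hr : 0 < r := hr
    have h5 := (memLp_unifBall_iff hr).2 h3
    refine ⟨h5.1, ?_⟩
    rw [← ENNReal.pow_le_pow_left_iff two_ne_zero, h5.eLpNorm_two_sq_eq_ofReal_integral,
      integral_unifBall, ← ENNReal.ofReal_pow (by positivity), pow_one, mul_pow]
    refine ENNReal.ofReal_le_ofReal ((le_abs_self _).trans (h4.trans (le_of_eq ?_)))
    rw [Real.norm_of_nonneg (by positivity)]
  · intro h
    refine ⟨?_, isLittleO_iff.2 fun c hc => ?_⟩
    · filter_upwards [h 1 one_pos, self_mem_nhdsWithin] with r h1 hr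
      exact (memLp_unifBall_iff hr).1 ⟨h1.1, h1.2.trans_lt ENNReal.ofReal_lt_top⟩
    · filter_upwards [h (Real.sqrt c) (by positivity), self_mem_nhdsWithin] with r h1 hr
      have hr : 0 < r := hr
      have h5 : MemLp (fun y => n y - n x - A (y - x)) 2 (unifBall x r) :=
        ⟨h1.1, h1.2.trans_lt ENNReal.ofReal_lt_top⟩
      have h2 := h1.2
      rw [← ENNReal.pow_le_pow_left_iff two_ne_zero, h5.eLpNorm_two_sq_eq_ofReal_integral,
        integral_unifBall, ← ENNReal.ofReal_pow (by positivity), pow_one, mul_pow,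
        Real.sq_sqrt hc.le, ENNReal.ofReal_le_ofReal_iff (by positivity)] at h2
      have h6 : 0 ≤ ⨍ y in ball x r, ‖n y - n x - A (y - x)‖ ^ 2 := by
        rw [← integral_unifBall]
        exact integral_nonneg fun y => by positivity
      rwa [Real.norm_of_nonneg h6, Real.norm_of_nonneg (by positivity)]

theorem HasL2GradientAt.unique (hA : HasL2GradientAt n A x) (hB : HasL2GradientAt n B x) :
    A = B := by
  have h := (hasL2GradientAt_iff.1 hA).sub (hasL2GradientAt_iff.1 hB)
  have : IsL2LittleO (fun y => (B - A) (y - x)) x 1 := by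
    refine h.congr (Eventually.of_forall fun r => Eventually.of_forall fun y => ?_)
    simp
  exact (sub_eq_zero.1 this.linear_eq_zero).symm

theorem HasL2GradientAt.l2Gradient_eq (hA : HasL2GradientAt n A x) : l2Gradient n x = A := by
  have h : L2DifferentiableAt n x := ⟨A, hA⟩
  rw [l2Gradient, dif_pos h]
  exact h.choose_spec.unique hA

/-! ### Quotient rule, orthogonality and the Frobenius norm -/

theorem IsL2LittleO.norm_sub_mul_norm {W : Type*} [NormedAddCommGroup W]
    {h : EuclideanSpace ℝ (Fin d) → W} {k : ℕ} (hh : IsL2LittleO h x k) :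
    IsL2LittleO (fun y => ‖y - x‖ * ‖h y‖) x (k + 1) := by
  refine hh.of_bound (hh.eventually_aestronglyMeasurable.mono fun r hr => ?_) 1 1
    (Eventually.of_forall fun r => ?_)
  · exact (by fun_prop : Continuous fun y => ‖y - x‖).aestronglyMeasurable.mul hr.norm
  · filter_upwards [ae_unifBall_mem x r] with y hy
    rw [mem_ball, dist_eq_norm] at hy
    rw [Real.norm_of_nonneg (by positivity), one_mul, pow_one]
    gcongr

theorem IsL2LittleO.const_smul {h : EuclideanSpace ℝ (Fin d) → V} {k : ℕ}
    (hh : IsL2LittleO h x k) (c : ℝ) : IsL2LittleO (fun y => c • h y) x k :=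
  hh.of_bound (j := 0) (g := fun y => c • h y)
    (hh.eventually_aestronglyMeasurable.mono fun _ hr => hr.const_smul c) ‖c‖
    (Eventually.of_forall fun _ => Eventually.of_forall fun y => by simp [norm_smul])

/-- The exact quotient rule, with c = s(x), c' = s(y), m = n(x), m' = n(y), a = ∇s(x)·(y - x) and b
= ∇u(x)(y - x). -/
theorem inv_smul_sub_identity {c : ℝ} (hc : c ≠ 0) (c' a : ℝ) (b m m' : V) :
    c⁻¹ • ((c' • m' - c • m - b) - (c' - c - a) • m' - a • (m' - m))
      = m' - m - c⁻¹ • (b - a • m) := by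
  have : m' - m - c⁻¹ • (b - a • m) = c⁻¹ • (c • (m' - m) - (b - a • m)) := by
    rw [smul_sub c⁻¹ (c • _), smul_smul, inv_mul_cancel₀ hc, one_smul]
  rw [this]
  congr 1
  module

theorem isL2LittleO_of_smul {s : EuclideanSpace ℝ (Fin d) → ℝ}
    {u : EuclideanSpace ℝ (Fin d) → EuclideanSpace ℝ (Fin d)} {g : EuclideanSpace ℝ (Fin d)}
    (hnm : ∀ᶠ r in 𝓝[>] (0 : ℝ), AEStronglyMeasurable n (unifBall x r))
    (hn1 : ∀ᶠ r in 𝓝[>] (0 : ℝ), ∀ᵐ y ∂(unifBall x r), ‖n y‖ = 1)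
    (huy : ∀ᶠ r in 𝓝[>] (0 : ℝ), ∀ᵐ y ∂(unifBall x r), u y = s y • n y)
    (hux : u x = s x • n x) (hsx : s x ≠ 0)
    (hu : IsL2LittleO (fun y => u y - u x - B (y - x)) x 1)
    (hs : IsL2LittleO (fun y => s y - s x - innerSL ℝ g (y - x)) x 1)
    (hn : IsL2LittleO (fun y => n y - n x) x 0) :
    IsL2LittleO (fun y => n y - n x - ((s x)⁻¹ • (B - vecTensor (n x) g)) (y - x)) x 1 := by
  have h2 : IsL2LittleO (fun y => (s y - s x - innerSL ℝ g (y - x)) • n y) x 1 := by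
    refine hs.of_bound (g := fun y => (s y - s x - innerSL ℝ g (y - x)) • n y)
      ((hs.eventually_aestronglyMeasurable.and hnm).mono fun r hr => hr.1.smul hr.2) 1 0
      (hn1.mono fun r hr => ?_)
    filter_upwards [hr] with y hy
    rw [norm_smul, hy]; simp
  have h3 : IsL2LittleO (fun y => innerSL ℝ g (y - x) • (n y - n x)) x 1 := by
    refine hn.norm_sub_mul_norm.of_bound (j := 0)
      (g := fun y => innerSL ℝ g (y - x) • (n y - n x)) (hn.eventually_aestronglyMeasurable.mono
      fun r hr => (by fun_prop : Continuous fun y => innerSL ℝ g (y - x)).aestronglyMeasurable.smul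
        hr) ‖innerSL ℝ g‖ (Eventually.of_forall fun r => Eventually.of_forall fun y => ?_)
    rw [norm_smul, Real.norm_of_nonneg (by positivity : 0 ≤ ‖y - x‖ * ‖n y - n x‖), pow_zero,
      mul_one, ← mul_assoc]
    gcongr
    exact (innerSL ℝ g).le_opNorm _
  have h4 := (hu.sub h2).sub h3
  have h5 := h4.const_smul (s x)⁻¹
  refine h5.congr (huy.mono fun r hr => hr.mono fun y hy => ?_)
  have h6 : ((s x)⁻¹ • (B - vecTensor (n x) g)) (y - x)
      = (s x)⁻¹ • (B (y - x) - innerSL ℝ g (y - x) • n x) := by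
    simp [vecTensor]
  rw [h6, hy, hux]
  exact inv_smul_sub_identity hsx _ _ _ _ _

/-- Differentiating |n|² = 1 in mean square: n(x)·A(y - x) = -|D|²/2 - n(x)·R, where D = n(y) - n(x)
and R is the remainder. The right side is o(r), so the linear map vanishes. -/
theorem HasL2GradientAt.inner_eq_zero (hA : HasL2GradientAt n A x) (hx : ‖n x‖ = 1)
    (hn1 : ∀ᶠ r in 𝓝[>] (0 : ℝ), ∀ᵐ y ∂(unifBall x r), ‖n y‖ = 1)
    (hn : IsL2LittleO (fun y => n y - n x) x 0) (v : EuclideanSpace ℝ (Fin d)) :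
    inner ℝ (n x) (A v) = 0 := by
  have hR := hasL2GradientAt_iff.1 hA
  have h1 : IsL2LittleO (fun y => 2 * ‖n y - n x - A (y - x)‖) x 1 :=
    hR.of_bound (j := 0) (hR.eventually_aestronglyMeasurable.mono fun r hr => hr.norm.const_mul 2) 2
      (Eventually.of_forall fun r => Eventually.of_forall fun y => by simp)
  have h2 : IsL2LittleO (fun y => ‖A‖ * (‖y - x‖ * ‖n y - n x‖)) x 1 :=
    hn.norm_sub_mul_norm.of_bound (j := 0)
      (hn.norm_sub_mul_norm.eventually_aestronglyMeasurable.mono fun r hr => hr.const_mul _) ‖A‖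
      (Eventually.of_forall fun r => Eventually.of_forall fun y => by simp)
  have h3 : IsL2LittleO (fun y => ((innerSL ℝ (n x)).comp A) (y - x)) x 1 := by
    refine (h1.add h2).of_bound (j := 0) (Eventually.of_forall fun r => (by fun_prop : Continuous
      fun y => ((innerSL ℝ (n x)).comp A) (y - x)).aestronglyMeasurable) 1
      (hn1.mono fun r hr => hr.mono fun y hy => ?_)
    rw [Real.norm_of_nonneg (by positivity : 0 ≤ 2 * ‖n y - n x - A (y - x)‖ +
      ‖A‖ * (‖y - x‖ * ‖n y - n x‖)), pow_zero, one_mul, one_mul]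
    simp only [ContinuousLinearMap.comp_apply, innerSL_apply_apply]
    set R := n y - n x - A (y - x) with hRdef
    set D := n y - n x with hD
    have hny : n y = n x + D := by rw [hD]; abel
    have hAeq : A (y - x) = D - R := by rw [hRdef]; abel
    have e1 : ‖n x + D‖ ^ 2 = ‖n x‖ ^ 2 + 2 * inner ℝ (n x) D + ‖D‖ ^ 2 :=
      norm_add_sq_real _ _
    rw [← hny, hy, hx] at e1
    have e2 : |inner ℝ (n x) R| ≤ ‖R‖ := by
      have := abs_real_inner_le_norm (n x) R
      rwa [hx, one_mul] at this
    have e3 : ‖D‖ ≤ 2 := by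
      have := norm_sub_le (n y) (n x)
      rw [hy, hx] at this
      linarith
    have e4 : ‖D‖ ≤ ‖R‖ + ‖A‖ * ‖y - x‖ := by
      have h5 : D = R + A (y - x) := by rw [hRdef]; abel
      have h6 := norm_add_le R (A (y - x))
      rw [← h5] at h6
      exact h6.trans (add_le_add le_rfl (A.le_opNorm _))
    -- One factor |D| is split as |R| + |A||y - x|. The other is bounded by 2 against R, but kept
    -- against |y - x|, where its smallness at a Lebesgue point is needed.
    have e5 : ‖D‖ ^ 2 ≤ 2 * ‖R‖ + ‖A‖ * (‖y - x‖ * ‖D‖) := by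
      have h7 := mul_le_mul_of_nonneg_left e4 (norm_nonneg D)
      have h8 := mul_le_mul_of_nonneg_right e3 (norm_nonneg R)
      nlinarith
    have e6 : 0 ≤ ‖A‖ * (‖y - x‖ * ‖D‖) := by positivity
    rw [hAeq, inner_sub_right, Real.norm_eq_abs]
    have e7 := abs_le.1 e2
    have e8 := sq_nonneg ‖D‖
    rw [abs_le]
    constructor <;> linarith
  have h4 := congrArg (fun L => L v) h3.linear_eq_zero
  simpa using h4

/-- Pythagoras column by column: column j of a ⊗ g is g_j a, and every column of A is orthogonal to
the unit vector a. -/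
theorem frobeniusSq_smul_add_vecTensor {a g : EuclideanSpace ℝ (Fin d)} (ha : ‖a‖ = 1)
    (hA : ∀ v, inner ℝ a (A v) = 0) (c : ℝ) :
    frobeniusSq (c • A + vecTensor a g) = ‖g‖ ^ 2 + c ^ 2 * frobeniusSq A := by
  have ha2 : ∑ i, a i ^ 2 = 1 := by rw [← EuclideanSpace.real_norm_sq_eq, ha, one_pow]
  have hA' : ∀ j, ∑ i, a i * A (EuclideanSpace.single j 1) i = 0 := fun j => by
    rw [← hA (EuclideanSpace.single j 1), PiLp.inner_apply]
    exact Finset.sum_congr rfl fun i _ => by simp [mul_comm]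
  have hg : ∀ j, inner ℝ g (EuclideanSpace.single j (1 : ℝ)) = g j := fun j => by
    rw [EuclideanSpace.inner_single_right]; simp
  rw [EuclideanSpace.real_norm_sq_eq, frobeniusSq, frobeniusSq, Finset.sum_comm,
    Finset.sum_comm (s := Finset.univ) (f := fun i j => (A (EuclideanSpace.single j 1) i) ^ 2),
    Finset.mul_sum, ← Finset.sum_add_distrib]
  refine Finset.sum_congr rfl fun j _ => ?_
  have : ∀ i, (c • A + vecTensor a g) (EuclideanSpace.single j 1) i
      = c * A (EuclideanSpace.single j 1) i + g j * a i := fun i => by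
    simp [vecTensor, hg]
  simp only [this]
  calc _ = ∑ i, (c ^ 2 * (A (EuclideanSpace.single j 1) i) ^ 2 +
        2 * c * g j * (a i * A (EuclideanSpace.single j 1) i) + g j ^ 2 * a i ^ 2) :=
        Finset.sum_congr rfl fun i _ => by ring
    _ = _ := by
      rw [Finset.sum_add_distrib, Finset.sum_add_distrib, ← Finset.mul_sum, ← Finset.mul_sum,
        ← Finset.mul_sum, hA', ha2]
      ring

end

end

/-- Weak gradients are determined almost everywhere; the statement holds for every choice `gs` of
the weak gradient of `s` and `Gu` of the weak gradient of `u`. The singular set is `{s = 0}`. -/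
theorem proposition2p1 {d : ℕ} (hd : 2 ≤ d) (Ω : Set (EuclideanSpace ℝ (Fin d)))
    (hΩ : IsOpen Ω) (s : EuclideanSpace ℝ (Fin d) → ℝ)
    (n u : EuclideanSpace ℝ (Fin d) → EuclideanSpace ℝ (Fin d))
    (hA : Admissible Ω s n u)
    (gs : EuclideanSpace ℝ (Fin d) → EuclideanSpace ℝ (Fin d)) (hgs : HasWeakGradient Ω s gs)
    (Gu : EuclideanSpace ℝ (Fin d) → (EuclideanSpace ℝ (Fin d) →L[ℝ] EuclideanSpace ℝ (Fin d)))
    (hGu : HasWeakDeriv Ω u Gu) :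
    (∀ᵐ x ∂(volume.restrict Ω), s x ≠ 0 → L2DifferentiableAt n x) ∧
    (∀ᵐ x ∂(volume.restrict Ω), s x ≠ 0 →
      l2Gradient n x = (s x)⁻¹ • (Gu x - vecTensor (n x) (gs x))) ∧
    (∀ᵐ x ∂(volume.restrict Ω), s x ≠ 0 →
      frobeniusSq (Gu x) = ‖gs x‖ ^ 2 + s x ^ 2 * frobeniusSq (l2Gradient n x)) := by
  obtain ⟨hs2, Gs', hGs', hGs'2⟩ := hA.memH1_s
  obtain ⟨hu2, Gu', hGu', hGu'2⟩ := hA.memH1_u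
  have hn0 := ae_restrict_isL2LittleO_sub hΩ le_top hA.memLinfty_n
  have key : ∀ᵐ x ∂(volume.restrict Ω), s x ≠ 0 →
      HasL2GradientAt n ((s x)⁻¹ • (Gu x - vecTensor (n x) (gs x))) x ∧
      ∀ v, inner ℝ (n x) (((s x)⁻¹ • (Gu x - vecTensor (n x) (gs x))) v) = 0 := by
    filter_upwards [hn0, hGs'.ae_isL2LittleO hΩ hs2 hGs'2, hGu'.ae_isL2LittleO hΩ hu2 hGu'2,
      hGs'.ae_eq hΩ hgs, hGu'.ae_eq hΩ hGu, hA.u_eq, hA.norm_n,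
      ae_restrict_mem hΩ.measurableSet] with x hnx hsx hux hgsx hGux huex hn1x hxΩ hs0
    rw [hgsx] at hsx
    rw [hGux] at hux
    have hn1 := eventually_ae_unifBall hΩ hxΩ hA.norm_n
    have hgrad := hasL2GradientAt_iff.2 (isL2LittleO_of_smul
      (eventually_aestronglyMeasurable_unifBall hΩ hxΩ hA.memLinfty_n.1) hn1
      (eventually_ae_unifBall hΩ hxΩ hA.u_eq) huex hs0 hux hsx hnx)
    exact ⟨hgrad, hgrad.inner_eq_zero hn1x hn1 hnx⟩
  refine ⟨?_, ?_, ?_⟩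
  · filter_upwards [key] with x hx hs0
    exact ⟨_, (hx hs0).1⟩
  · filter_upwards [key] with x hx hs0
    exact (hx hs0).1.l2Gradient_eq
  · filter_upwards [key, hA.norm_n] with x hx hn1 hs0
    obtain ⟨h1, h2⟩ := hx hs0
    -- Recombine s ∇n + n ⊗ ∇s into ∇u.
    rw [h1.l2Gradient_eq, ← frobeniusSq_smul_add_vecTensor hn1 h2, smul_smul,
      mul_inv_cancel₀ hs0, one_smul, sub_add_cancel]
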